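/- Let $M,a,e,\Lambda$ be real with $\Lambda>0$, $a\neq0$, and consider the Kerr–Newman–de Sitter metric ($G=c=1$) $$ds^2=\frac{\Delta_r}{\Xi^2\rho^2}(dt-a\sin^2\theta\,d\phi)^2-\frac{\rho^2}{\Delta_r}dr^2-\frac{\rho^2}{\Delta_\theta}d\theta^2-\frac{\Delta_\theta\sin^2\theta}{\Xi^2\rho^2}\bigl(a\,dt-(r^2+a^2)d\phi\bigr)^2,$$ $\Delta_r=(1-\tfrac{\Lambda}{3}r^2)(r^2+a^2)-2Mr+e^2$, $\Delta_\theta=1+\tfrac{a^2\Lambda}{3}\cos^2\theta$, $\Xi=1+\tfrac{a^2\Lambda}{3}$, $\rho^2=r^2+a^2\cos^2\theta$. Consider a timelike geodesic with four-velocity $U$ ($g(U,U)=1$) in the region $\Delta_r>0$, $\rho^2>0$, which is polar, i.e. has angular momentum $L=-g(\partial_\phi,U)=0$; it may cross the axis. Let $E=g(\partial_t,U)$ be its energy and $Q=K-\Xi^2(L-aE)^2$ its Carter constant, where $$K=\frac{\rho^4(U^\theta)^2}{\Delta_\theta}+\frac{\Delta_\theta\sin^2\theta}{\Xi^2}\bigl(aU^t-(r^2+a^2)U^\phi\bigr)^2+a^2\cos^2\theta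 .$$ Suppose that the radial polynomial has only real roots, $$R'(r)=\Xi^2(r^2+a^2)^2E^2-\Delta_r\,(r^2+Q+\Xi^2a^2E^2)=\tfrac{\Lambda}{3}(r-r_\Lambda^1)(r-r_A)(r-r_P)(r-\gamma)(r-\delta)(r-r_\Lambda^2),$$ with $r_\Lambda^1>r_A>r_P$ and $r_P>\gamma,\delta,r_\Lambda^2$, and that, for $z=\cos^2\theta$, with $\Theta'=(Q+\Xi^2a^2E^2-a^2\cos^2\theta)\Delta_\theta-\Xi^2a^2E^2\sin^2\theta$, $$\sin^2\theta\;\Theta'=\tfrac{a^4\Lambda}{3}(z-z_\Lambda)(z-z_+)(z-z_-)\quad\text{as polynomials in } z,\qquad z_\Lambda<0<z_-<z_+ .$$ Suppose that on a proper-time interval $[\tau_0,\tau_1]$ the radius performs one complete oscillation, increasing strictly from the periapsis $r_P$ to the apoapsis $r_A$ and then decreasing strictly back to $r_P$, and that the geodesic starts at an extremal latitude, $\cos^2\theta(\tau_0)=z_-$ (this is the axis when $z_-=1$). Put $$\omega=\frac{r_A-r_P}{r_\Lambda^1-r_P},\qquad H=\sqrt{(r_A-r_P)(r_A-\gamma)(r_A-\delta)(r_A-r_\Lambda^2)},\qquad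 \boldsymbol\beta=(\tfrac12,\tfrac12,\tfrac12),$$ $$\mathbf x=\Bigl(\omega\frac{r_\Lambda^1-\gamma}{r_A-\gamma},\ \omega\frac{r_\Lambda^1-\delta}{r_A-\delta},\ \omega\frac{r_\Lambda^1-r_\Lambda^2}{r_A-r_\Lambda^2}\Bigr),\qquad \omega_1=\frac{z_+-z_-}{z_+},\qquad \varkappa^2=\frac{\omega_1z_\Lambda}{z_\Lambda-z_-}.$$ Then Lauricella's series $F_D(\tfrac12,\boldsymbol\beta,1,\mathbf x)$ and $F_D(\tfrac32,\boldsymbol\beta,2,\mathbf x)$ converge absolutely, $1/\sqrt{R'}$ is integrable between $r_P$ and $r_A$, and $$2\int_{r_A}^{r_P}\frac{dr}{\sqrt{R'}}=T:=\frac{2\sqrt\omega}{\sqrt{\Lambda/3}\,H}\Bigl[-\pi F_D(\tfrac12,\boldsymbol\beta,1,\mathbf x)+\frac{\pi}{2}\,\omega F_D(\tfrac32,\boldsymbol\beta,2,\mathbf x)\Bigr].$$ Moreover the polar angle $\theta\in[0,\pi]$ reached after the oscillation (at $\tau_1$) is $$\theta=\arccos\bigl(\sqrt z\bigr)\ \text{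 or }\ \theta=\arccos\bigl(-\sqrt z\bigr),\qquad z=\frac{-z_-}{\omega_1\,\mathrm{sn}^2\!\Bigl(T\,\dfrac{\sqrt{z_\Lambda-z_-}\,\sqrt{z_+-z_-}\;a^2}{\sqrt{\omega_1}}\sqrt{\dfrac{\Lambda}{3}},\ \varkappa^2\Bigr)-1}\in[0,1].$$ Here $\mathrm{sn}(\cdot,\varkappa^2)$ is Jacobi's elliptic function of a complex argument with squared modulus $\varkappa^2\in(0,1)$. The argument is purely imaginary, because $\sqrt{z_\Lambda-z_-}$ is; the denominator does not vanish; and $z=0$ if the argument is a pole of $\mathrm{sn}$. -/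

import Mathlib

open Set MeasureTheory Filter

noncomputable section

/-! ### Special functions -/

/-- The general term of the Lauricella series
`F_D(a, b, c, x) = ∑ (a)_{n₁+⋯+nₘ} (b₁)_{n₁} ⋯ (bₘ)_{nₘ} / ((c)_{n₁+⋯+nₘ} n₁! ⋯ nₘ!) x₁^n₁ ⋯ xₘ^nₘ`,
where `(a)_n = a (a + 1) ⋯ (a + n - 1)` is the Pochhammer symbol. -/
def lauricellaTerm {m : ℕ} (a : ℝ) (b : Fin m → ℝ) (c : ℝ) (x : Fin m → ℝ) (n : Fin m → ℕ) : ℝ :=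
  ((ascPochhammer ℝ (∑ i, n i)).eval a * ∏ i, (ascPochhammer ℝ (n i)).eval (b i)) /
      ((ascPochhammer ℝ (∑ i, n i)).eval c * ∏ i, ((n i).factorial : ℝ)) * ∏ i, x i ^ n i

/-- Lauricella's fourth hypergeometric function `F_D` of `m` variables (sum of its power series). -/
def lauricellaFD {m : ℕ} (a : ℝ) (b : Fin m → ℝ) (c : ℝ) (x : Fin m → ℝ) : ℝ :=
  ∑' n : Fin m → ℕ, lauricellaTerm a b c x n

/-- The incomplete elliptic integral of the first kind
`F(φ, k²) = ∫₀^φ dψ / √(1 - k² sin² ψ)`; the argument `k2` is the squared modulus. -/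
def ellipticF (k2 φ : ℝ) : ℝ := ∫ ψ in (0 : ℝ)..φ, 1 / √(1 - k2 * Real.sin ψ ^ 2)

/-- The complete elliptic integral of the first kind. -/
def ellipticK (k2 : ℝ) : ℝ := ellipticF k2 (Real.pi / 2)

/-- The Abel-Jacobi amplitude: the inverse of `φ ↦ F(φ, k²)`,
which is a bijection of the real line when `k² < 1`. -/
def jacobiAm (k2 u : ℝ) : ℝ := Function.invFun (ellipticF k2) u

/-- The real Jacobi function `sn (u, k²) = sin (am (u, k²))`. -/
def jacobiSnReal (k2 u : ℝ) : ℝ := Real.sin (jacobiAm k2 u)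

/-- The real Jacobi function `cn (u, k²) = cos (am (u, k²))`. -/
def jacobiCnReal (k2 u : ℝ) : ℝ := Real.cos (jacobiAm k2 u)

/-- The real Jacobi function `dn (u, k²) = √(1 - k² sn² (u, k²))`. -/
def jacobiDnReal (k2 u : ℝ) : ℝ := √(1 - k2 * jacobiSnReal k2 u ^ 2)

/-- Jacobi's elliptic function `sn (w, k²)` of a complex argument `w = u + i v`, for `0 < k² < 1`,
in terms of its real and imaginary parts: with `s, c, d` the functions `sn, cn, dn` at `(u, k²)`
and `s', c', d'` the same functions at `(v, 1 - k²)`,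
`sn (u + i v, k²) = (s d' + i c d s' c') / (1 - d² s'²)`.
At the poles of `sn` the value of this expression is meaningless. -/
def jacobiSn (k2 : ℝ) (w : ℂ) : ℂ :=
  (((jacobiSnReal k2 w.re * jacobiDnReal (1 - k2) w.im : ℝ) : ℂ) +
      Complex.I * ((jacobiCnReal k2 w.re * jacobiDnReal k2 w.re *
        jacobiSnReal (1 - k2) w.im * jacobiCnReal (1 - k2) w.im : ℝ) : ℂ)) /
    ((1 - jacobiDnReal k2 w.re ^ 2 * jacobiSnReal (1 - k2) w.im ^ 2 : ℝ) : ℂ)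

/-- The poles of `sn (·, k²)`, `0 < k² < 1`: the points `2 j K + (2 l + 1) i K'`, `j, l ∈ ℤ`,
where `K = K(k²)` and `K' = K(1 - k²)`. -/
def IsJacobiSnPole (k2 : ℝ) (w : ℂ) : Prop :=
  ∃ j l : ℤ, w = 2 * (j : ℂ) * (ellipticK k2 : ℂ) +
    (2 * (l : ℂ) + 1) * (ellipticK (1 - k2) : ℂ) * Complex.I

lemma one_sub_mul_sin_sq_pos {k2 : ℝ} (hk : k2 < 1) (ψ : ℝ) : 0 < 1 - k2 * Real.sin ψ ^ 2 := by
  have h1 := Real.sin_sq_le_one ψ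
  rcases (sq_nonneg (Real.sin ψ)).eq_or_lt with h2 | h2
  · rw [← h2]
    norm_num
  · nlinarith [mul_pos (sub_pos.2 hk) h2]

lemma ellipticF_integrand_continuous {k2 : ℝ} (hk : k2 < 1) :
    Continuous fun ψ : ℝ => 1 / √(1 - k2 * Real.sin ψ ^ 2) := by
  refine continuous_const.div (by fun_prop) fun ψ => ?_
  exact (Real.sqrt_pos.2 (one_sub_mul_sin_sq_pos hk ψ)).ne'

lemma ellipticF_hasDerivAt {k2 : ℝ} (hk : k2 < 1) (φ : ℝ) :
    HasDerivAt (ellipticF k2) (1 / √(1 - k2 * Real.sin φ ^ 2)) φ :=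
  (ellipticF_integrand_continuous hk).integral_hasStrictDerivAt 0 φ |>.hasDerivAt

/-- The elliptic integral is indeed invertible for `k² < 1`. -/
lemma ellipticF_bijective {k2 : ℝ} (hk : k2 < 1) : Function.Bijective (ellipticF k2) := by
  have hpos : ∀ ψ : ℝ, 0 < 1 - k2 * Real.sin ψ ^ 2 := one_sub_mul_sin_sq_pos hk
  set c : ℝ := 1 / √(1 + |k2|) with hc
  have hc0 : 0 < c := by positivity
  have hle : ∀ ψ : ℝ, c ≤ 1 / √(1 - k2 * Real.sin ψ ^ 2) := fun ψ => by
    have h1 := Real.sin_sq_le_one ψ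
    have h2 := sq_nonneg (Real.sin ψ)
    refine one_div_le_one_div_of_le (Real.sqrt_pos.2 (hpos ψ)) (Real.sqrt_le_sqrt ?_)
    nlinarith [neg_abs_le k2, abs_nonneg k2]
  have hmono : Monotone fun φ => ellipticF k2 φ - c * φ := by
    have hd : ∀ φ, HasDerivAt (fun φ => ellipticF k2 φ - c * φ)
        (1 / √(1 - k2 * Real.sin φ ^ 2) - c) φ := fun φ => by
      have h := (ellipticF_hasDerivAt hk φ).sub ((hasDerivAt_id φ).const_mul c)
      rw [mul_one] at h
      exact h
    refine monotone_of_deriv_nonneg (fun φ => (hd φ).differentiableAt) fun φ => ?_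
    rw [(hd φ).deriv]
    linarith [hle φ]
  have h0 : ellipticF k2 0 = 0 := by simp [ellipticF]
  have hcont : Continuous (ellipticF k2) :=
    continuous_iff_continuousAt.2 fun φ => (ellipticF_hasDerivAt hk φ).continuousAt
  constructor
  · have hs : StrictMono (ellipticF k2) := fun x y hxy => by
      have := hmono hxy.le
      simp only at this
      nlinarith
    exact hs.injective
  · refine hcont.surjective ?_ ?_
    · refine tendsto_atTop_mono' _ ?_ (tendsto_id.const_mul_atTop hc0)
      filter_upwards [eventually_ge_atTop 0] with x hx
      have := hmono hx
      simp only [h0] at this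
      simp only [id]
      linarith
    · refine tendsto_atBot_mono' _ ?_ (tendsto_id.const_mul_atBot hc0)
      filter_upwards [eventually_le_atBot 0] with x hx
      have := hmono hx
      simp only [h0] at this
      simp only [id]
      linarith

lemma jacobiAm_zero {k2 : ℝ} (hk : k2 < 1) : jacobiAm k2 0 = 0 := by
  have h0 : ellipticF k2 0 = 0 := by simp [ellipticF]
  have := Function.leftInverse_invFun (ellipticF_bijective hk).injective 0
  rwa [h0] at this

/-- On the real axis `sn` is the sine of the amplitude. -/
lemma jacobiSn_ofReal {k2 : ℝ} (hk : 0 < k2) (u : ℝ) :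
    jacobiSn k2 u = (jacobiSnReal k2 u : ℂ) := by
  have h : jacobiAm (1 - k2) 0 = 0 := jacobiAm_zero (by linarith)
  simp [jacobiSn, jacobiSnReal, jacobiDnReal, h]

/-- Jacobi's imaginary transformation `sn (i v, k²) = i sn (v, 1 - k²) / cn (v, 1 - k²)`. -/
lemma jacobiSn_I_mul {k2 : ℝ} (hk : k2 < 1) (v : ℝ) :
    jacobiSn k2 (Complex.I * v) =
      Complex.I * (jacobiSnReal (1 - k2) v / jacobiCnReal (1 - k2) v : ℝ) := by
  have h : jacobiAm k2 0 = 0 := jacobiAm_zero hk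
  have h2 : 1 - Real.sin (jacobiAm (1 - k2) v) ^ 2 = Real.cos (jacobiAm (1 - k2) v) ^ 2 := by
    linarith [Real.sin_sq_add_cos_sq (jacobiAm (1 - k2) v)]
  by_cases hc : Real.cos (jacobiAm (1 - k2) v) = 0
  · simp [jacobiSn, jacobiSnReal, jacobiDnReal, jacobiCnReal, h, hc]
  · have hc' : Complex.cos (jacobiAm (1 - k2) v : ℂ) ≠ 0 := by exact_mod_cast hc
    have h2' : 1 - Complex.sin (jacobiAm (1 - k2) v : ℂ) ^ 2
        = Complex.cos (jacobiAm (1 - k2) v : ℂ) ^ 2 := by exact_mod_cast h2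
    simp [jacobiSn, jacobiSnReal, jacobiDnReal, jacobiCnReal, h, h2']
    field_simp

/-! ### Kerr-Newman-de Sitter spacetime -/

/-- Parameters of the Kerr-Newman-(anti-)de Sitter metric in units `G = c = 1`:
mass `M`, Kerr (spin) parameter `a`, electric charge `e`, cosmological constant `Λ`. -/
structure KNdS where
  M : ℝ
  a : ℝ
  e : ℝ
  Λ : ℝ

namespace KNdS

/-- `Ξ = 1 + a² Λ / 3`. -/
def Xi (p : KNdS) : ℝ := 1 + p.a ^ 2 * p.Λ / 3

/-- `Δ_θ = 1 + (a² Λ / 3) cos² θ`. -/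
def deltaTheta (p : KNdS) (θ : ℝ) : ℝ := 1 + p.a ^ 2 * p.Λ / 3 * Real.cos θ ^ 2

/-- `Δ_r = (1 - (Λ / 3) r²) (r² + a²) - 2 M r + e²`. -/
def deltaR (p : KNdS) (r : ℝ) : ℝ :=
  (1 - p.Λ / 3 * r ^ 2) * (r ^ 2 + p.a ^ 2) - 2 * p.M * r + p.e ^ 2

/-- `ρ² = r² + a² cos² θ`. -/
def rhoSq (p : KNdS) (r θ : ℝ) : ℝ := r ^ 2 + p.a ^ 2 * Real.cos θ ^ 2

/-- The Kerr-Newman-de Sitter metric `g(u, v)` at the point `x = (t, r, θ, φ)` (Boyer-Lindquist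
coordinates, signature `+ - - -`), as a bilinear form in the coordinate vectors `u`, `v`:
`ds² = Δ_r / (Ξ² ρ²) (dt - a sin² θ dφ)² - (ρ² / Δ_r) dr² - (ρ² / Δ_θ) dθ²
        - Δ_θ sin² θ / (Ξ² ρ²) (a dt - (r² + a²) dφ)²`. -/
def metric (p : KNdS) (x u v : Fin 4 → ℝ) : ℝ :=
  p.deltaR (x 1) / (p.Xi ^ 2 * p.rhoSq (x 1) (x 2)) *
      (u 0 - p.a * Real.sin (x 2) ^ 2 * u 3) * (v 0 - p.a * Real.sin (x 2) ^ 2 * v 3)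
    - p.rhoSq (x 1) (x 2) / p.deltaR (x 1) * u 1 * v 1
    - p.rhoSq (x 1) (x 2) / p.deltaTheta (x 2) * u 2 * v 2
    - p.deltaTheta (x 2) * Real.sin (x 2) ^ 2 / (p.Xi ^ 2 * p.rhoSq (x 1) (x 2)) *
      (p.a * u 0 - (x 1 ^ 2 + p.a ^ 2) * u 3) * (p.a * v 0 - (x 1 ^ 2 + p.a ^ 2) * v 3)

/-- `X` is, on the open set `I`, a timelike geodesic parametrised by proper time, away from the
horizons and the ring singularity, in a region where `r` is a spacelike coordinate (`Δ_r > 0`,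
`ρ² > 0`), as for any bound orbit outside the black hole.
The geodesic equation is written in the covariant form
`d/dτ (g_{iν} ẋ^ν) = (1/2) (∂_i g_{μν}) ẋ^μ ẋ^ν`, which makes sense at the axis `sin θ = 0` too.
The coordinate `θ` takes values in `ℝ`: a geodesic crossing the axis is described by a smooth curve
along which `θ` runs through a multiple of `π` (the points `(θ, φ)` and `(-θ, φ + π)` coincide, and
`θ` is defined modulo `2π`); the usual polar angle in `[0, π]` is `arccos (cos θ)`. -/
structure IsTimelikeGeodesicOn (p : KNdS) (X : ℝ → Fin 4 → ℝ) (I : Set ℝ) : Prop where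
  contDiffOn : ContDiffOn ℝ 2 X I
  deltaR_pos : ∀ τ ∈ I, 0 < p.deltaR (X τ 1)
  rhoSq_pos : ∀ τ ∈ I, 0 < p.rhoSq (X τ 1) (X τ 2)
  properTime : ∀ τ ∈ I, p.metric (X τ) (deriv X τ) (deriv X τ) = 1
  geodesic : ∀ τ ∈ I, ∀ i : Fin 4,
    HasDerivAt (fun s => p.metric (X s) (deriv X s) (Pi.single i 1))
      (1 / 2 * deriv (fun h => p.metric (Function.update (X τ) i h) (deriv X τ) (deriv X τ))
        (X τ i)) τ

/-- Specific energy `E = g(ξ, U)`, `ξ = ∂_t`. -/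
def energy (p : KNdS) (x u : Fin 4 → ℝ) : ℝ := p.metric x u (Pi.single 0 1)

/-- Specific angular momentum about the axis, `L = - g(ψ, U)`, `ψ = ∂_φ`. -/
def angularMomentum (p : KNdS) (x u : Fin 4 → ℝ) : ℝ := -p.metric x u (Pi.single 3 1)

/-- The value `K = K_{μν} U^μ U^ν` of the Killing tensor:
`K = ρ⁴ (U^θ)² / Δ_θ + (Δ_θ sin² θ / Ξ²) (a U^t - (r² + a²) U^φ)² + a² cos² θ g(U, U)`. -/
def killingTensor (p : KNdS) (x u : Fin 4 → ℝ) : ℝ :=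
  p.rhoSq (x 1) (x 2) ^ 2 * u 2 ^ 2 / p.deltaTheta (x 2)
    + p.deltaTheta (x 2) * Real.sin (x 2) ^ 2 / p.Xi ^ 2 *
      (p.a * u 0 - (x 1 ^ 2 + p.a ^ 2) * u 3) ^ 2
    + p.a ^ 2 * Real.cos (x 2) ^ 2 * p.metric x u u

/-- Carter's constant `Q = K - Ξ² (L - a E)²`. -/
def carterConstant (p : KNdS) (x u : Fin 4 → ℝ) : ℝ :=
  p.killingTensor x u - p.Xi ^ 2 * (p.angularMomentum x u - p.a * p.energy x u) ^ 2

/-- The sextic radial polynomial (for unit rest mass)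
`R' = Ξ² [(r² + a²) E - a L]² - Δ_r (r² + Q + Ξ² (L - a E)²)`. -/
def radialR (p : KNdS) (E L Q r : ℝ) : ℝ :=
  p.Xi ^ 2 * ((r ^ 2 + p.a ^ 2) * E - p.a * L) ^ 2
    - p.deltaR r * (r ^ 2 + Q + p.Xi ^ 2 * (L - p.a * E) ^ 2)

/-- The angular polynomial: `sin² θ · Θ'` as a function of `z = cos² θ`, where (for unit rest mass)
`Θ' = [Q + Ξ² (L - a E)² - a² cos² θ] Δ_θ - Ξ² (a E sin² θ - L)² / sin² θ`.
It is a cubic in `z` with leading coefficient `a⁴ Λ / 3`, and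
`dθ / √Θ' = ∓ dz / (2 √z √(angularCubic z))`. -/
def angularCubic (p : KNdS) (E L Q z : ℝ) : ℝ :=
  (Q + p.Xi ^ 2 * (L - p.a * E) ^ 2 - p.a ^ 2 * z) * (1 + p.a ^ 2 * p.Λ / 3 * z) * (1 - z)
    - p.Xi ^ 2 * (p.a * E * (1 - z) - L) ^ 2

end KNdS

/-- On `[τ₀, τ₁]` the radius performs one complete oscillation: it increases strictly from the
periapsis `rP` to the apoapsis `rA` and then decreases strictly back to `rP`. -/
def IsRadialOscillation (r : ℝ → ℝ) (τ₀ τ₁ rP rA : ℝ) : Prop :=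
  ∃ τm ∈ Ioo τ₀ τ₁, r τ₀ = rP ∧ r τm = rA ∧ r τ₁ = rP ∧
    StrictMonoOn r (Icc τ₀ τm) ∧ StrictAntiOn r (Icc τm τ₁)

end

/-! In Mino time λ, with dλ = dτ/ρ², the polar geodesic separates: (dr/dλ)² = R'(r), while y = cos θ
satisfies y'² = P(y²) and y'' = y P'(y²), where P is `angularCubic`. The radial motion alone fixes
the Mino length of the oscillation, and the angular motion is then evaluated after that length.

Radial side. The substitution sin²ψ = (rA - r)/(ω (r₁ - r)), with r₁ the largest root, turns dr/√R'
into (1 - ω sin²ψ) ∏ (1 - xᵢ sin²ψ)^(-1/2) dψ up to a constant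
(`exists_antideriv_one_div_sqrt_sextic`). The ordering of the roots gives 0 ≤ xᵢ < 1, so the factors
expand in binomial series. Termwise integration with Wallis' formula produces the two Lauricella
functions (`integral_one_sub_mul_prod_eq_lauricella`). The integral in the statement runs from rA
down to rP, so T is negative and the elapsed Mino time is -T.

Separation. E and L are conserved because t and φ are cyclic. For L = 0 the Killing tensor value
reduces to a function of θ and ρ² dθ/dτ, and the θ component of the geodesic equation makes it
constant (`killingTensor_eq`). The radial equation is then algebra from g(U,U) = 1.

Angular side. The first-order equation y'² = P(y²) does not determine y through turning points, so
the second-order one is used: `polarCos` solves it explicitly, and Lipschitz uniqueness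
(`eq_of_oscillator`) identifies it with cos θ. Working with cos θ instead of θ makes axis crossings
harmless. The real solution has parameter 1 - k2, and Jacobi's imaginary transformation rewrites it
as the stated expression in sn of an imaginary argument; poles of sn correspond to passages through
the equator. -/

noncomputable section

/-! ### Lauricella series as period integrals -/

/-- The binomial series `(1 - u)^(-b) = ∑ (b)ₙ / n! uⁿ`. -/
lemma hasSum_ascPochhammer_div_factorial (b : ℝ) {u : ℝ} (hu : |u| < 1) :
    HasSum (fun n : ℕ => (ascPochhammer ℝ n).eval b / (n.factorial : ℝ) * u ^ n)
      (1 / (1 - u) ^ b) := by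
  have h := (Real.one_div_one_sub_rpow_hasFPowerSeriesOnBall_zero b).hasSum (y := u) (by
    simp [enorm_eq_nnnorm, ← NNReal.coe_lt_coe, hu])
  rw [zero_add] at h
  refine h.congr_fun fun n => ?_
  have hn : (n.factorial : ℝ) ≠ 0 := by positivity
  have h1 := Ring.factorial_nsmul_multichoose_eq_ascPochhammer b n
  rw [Polynomial.ascPochhammer_smeval_eq_eval, nsmul_eq_mul] at h1
  have h2 : Ring.choose (b + n - 1) n = Ring.multichoose b n := by
    rw [Ring.choose]
    congr 1
    ring
  rw [← h1, FormalMultilinearSeries.ofScalars_apply_eq, h2]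
  field_simp
  simp [mul_comm]

lemma hasSum_ascPochhammer_half {u : ℝ} (hu : |u| < 1) :
    HasSum (fun n : ℕ => (ascPochhammer ℝ n).eval (1 / 2) / (n.factorial : ℝ) * u ^ n)
      (1 / √(1 - u)) := by
  have h := hasSum_ascPochhammer_div_factorial (1 / 2) hu
  rwa [← Real.sqrt_eq_rpow] at h

lemma hasSum_mul_of_nonneg {ι κ : Type*} {f : ι → ℝ} {g : κ → ℝ} {s t : ℝ} (hf : HasSum f s)
    (hg : HasSum g t) (hf0 : ∀ i, 0 ≤ f i) (hg0 : ∀ j, 0 ≤ g j) :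
    HasSum (fun q : ι × κ => f q.1 * g q.2) (s * t) :=
  hf.mul hg (hf.summable.mul_of_nonneg hg.summable hf0 hg0)

/-- A finite product of convergent series of nonnegative terms is the series of the products. -/
lemma hasSum_prod_pi_of_nonneg {m : ℕ} (f : Fin m → ℕ → ℝ) (s : Fin m → ℝ)
    (hf : ∀ i n, 0 ≤ f i n) (h : ∀ i, HasSum (f i) (s i)) :
    HasSum (fun n : Fin m → ℕ => ∏ i, f i (n i)) (∏ i, s i) := by
  induction m with
  | zero => simp
  | succ m ih =>
    have ih' := ih (fun i => f i.succ) (fun i => s i.succ) (fun i => hf _) (fun i => h _)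
    have h2 := hasSum_mul_of_nonneg (h 0) ih' (hf 0)
      (fun n => Finset.prod_nonneg fun i _ => hf i.succ (n i))
    rw [Fin.prod_univ_succ, ← (Fin.consEquiv fun _ => ℕ).hasSum_iff]
    refine h2.congr_fun fun n => ?_
    simp [Fin.consEquiv, Fin.prod_univ_succ]

/-- Wallis' product in Pochhammer form. It supplies the coefficient depending on ∑ nᵢ alone that
couples the separate binomial series into a series of type F_D. -/
lemma integral_sin_pow_even_eq_ascPochhammer (n : ℕ) :
    ∫ ψ in (0 : ℝ)..Real.pi, Real.sin ψ ^ (2 * n) =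
      Real.pi * ((ascPochhammer ℝ n).eval (1 / 2) / (n.factorial : ℝ)) := by
  rw [integral_sin_pow_even]
  congr 1
  induction n with
  | zero => simp
  | succ n ih =>
    rw [Finset.prod_range_succ, ih, ascPochhammer_succ_eval, Nat.factorial_succ]
    push_cast
    field_simp
    ring

lemma ascPochhammer_half_nonneg (n : ℕ) : 0 ≤ (ascPochhammer ℝ n).eval (1 / 2) :=
  (ascPochhammer_pos n _ (by norm_num)).le

/-- Expansion of the period integral `∫ sin^(2k) ψ ∏ (1 - xᵢ sin² ψ)^(-1/2) dψ` in powers of `x`. -/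
lemma hasSum_integral_sin_pow_mul_prod {m : ℕ} (x : Fin m → ℝ) (hx0 : ∀ i, 0 ≤ x i)
    (hx1 : ∀ i, x i < 1) (k : ℕ) :
    HasSum (fun n : Fin m → ℕ => (∫ ψ in (0 : ℝ)..Real.pi, Real.sin ψ ^ (2 * (∑ i, n i + k))) *
        ∏ i, ((ascPochhammer ℝ (n i)).eval (1 / 2) / ((n i).factorial : ℝ) * x i ^ n i))
      (∫ ψ in (0 : ℝ)..Real.pi,
        Real.sin ψ ^ (2 * k) * ∏ i, 1 / √(1 - x i * Real.sin ψ ^ 2)) := by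
  have hs : ∀ ψ, HasSum (fun n : Fin m → ℕ => Real.sin ψ ^ (2 * (∑ i, n i + k)) *
        ∏ i, ((ascPochhammer ℝ (n i)).eval (1 / 2) / ((n i).factorial : ℝ) * x i ^ n i))
      (Real.sin ψ ^ (2 * k) * ∏ i, 1 / √(1 - x i * Real.sin ψ ^ 2)) := fun ψ => by
    have hu : ∀ i, |x i * Real.sin ψ ^ 2| < 1 := fun i => by
      rw [abs_of_nonneg (mul_nonneg (hx0 i) (sq_nonneg _))]
      linarith [one_sub_mul_sin_sq_pos (hx1 i) ψ]
    have h := (hasSum_prod_pi_of_nonneg _ _ (fun i n => by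
      have := ascPochhammer_half_nonneg n
      have := hx0 i
      positivity) fun i => hasSum_ascPochhammer_half (hu i)).mul_left (Real.sin ψ ^ (2 * k))
    refine h.congr_fun fun n => ?_
    rw [mul_add, pow_add, mul_comm (Real.sin ψ ^ (2 * ∑ i, n i)), mul_assoc, Finset.mul_sum,
      ← Finset.prod_pow_eq_pow_sum, ← Finset.prod_mul_distrib]
    congr 1
    refine Finset.prod_congr rfl fun i _ => ?_
    rw [mul_pow, ← pow_mul]
    ring
  have hnn : ∀ ψ (n : Fin m → ℕ), 0 ≤ Real.sin ψ ^ (2 * (∑ i, n i + k)) *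
        ∏ i, ((ascPochhammer ℝ (n i)).eval (1 / 2) / ((n i).factorial : ℝ) * x i ^ n i) :=
    fun ψ n => mul_nonneg (by rw [pow_mul]; positivity) (Finset.prod_nonneg fun i _ => by
      have := ascPochhammer_half_nonneg (n i)
      have := hx0 i
      positivity)
  simp_rw [← intervalIntegral.integral_mul_const]
  -- Every term is nonnegative and thus dominates itself. The sum of these bounds is the limit
  -- integrand, which is continuous because all `x i < 1`.
  refine intervalIntegral.hasSum_integral_of_dominated_convergence
    (fun n ψ => Real.sin ψ ^ (2 * (∑ i, n i + k)) *
        ∏ i, ((ascPochhammer ℝ (n i)).eval (1 / 2) / ((n i).factorial : ℝ) * x i ^ n i))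
    (fun n => Continuous.aestronglyMeasurable (by fun_prop))
    (fun n => ae_of_all _ fun ψ _ => (Real.norm_of_nonneg (hnn ψ n)).le)
    (ae_of_all _ fun ψ _ => (hs ψ).summable) ?_ (ae_of_all _ fun ψ _ => hs ψ)
  simp_rw [fun ψ => (hs ψ).tsum_eq]
  refine Continuous.intervalIntegrable ?_ _ _
  exact (by fun_prop : Continuous fun ψ : ℝ => Real.sin ψ ^ (2 * k)).mul
    (continuous_finsetProd _ fun i _ => ellipticF_integrand_continuous (hx1 i))

/-- `F_D(1/2, (1/2, …, 1/2), 1, x)` as a complete hyperelliptic integral. -/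
lemma hasSum_lauricellaTerm_half_one {m : ℕ} (x : Fin m → ℝ) (hx0 : ∀ i, 0 ≤ x i)
    (hx1 : ∀ i, x i < 1) :
    HasSum (lauricellaTerm (1 / 2) (fun _ => 1 / 2) 1 x)
      ((∫ ψ in (0 : ℝ)..Real.pi, ∏ i, 1 / √(1 - x i * Real.sin ψ ^ 2)) / Real.pi) := by
  have h := (hasSum_integral_sin_pow_mul_prod x hx0 hx1 0).div_const Real.pi
  simp only [mul_zero, pow_zero, one_mul, add_zero] at h
  refine h.congr_fun fun n => ?_
  rw [integral_sin_pow_even_eq_ascPochhammer, Finset.prod_mul_distrib, Finset.prod_div_distrib,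
    lauricellaTerm, ascPochhammer_eval_one]
  have := Real.pi_ne_zero
  field_simp

/-- `F_D(3/2, (1/2, …, 1/2), 2, x)` as a complete hyperelliptic integral. -/
lemma hasSum_lauricellaTerm_three_half_two {m : ℕ} (x : Fin m → ℝ) (hx0 : ∀ i, 0 ≤ x i)
    (hx1 : ∀ i, x i < 1) :
    HasSum (lauricellaTerm (3 / 2) (fun _ => 1 / 2) 2 x)
      ((∫ ψ in (0 : ℝ)..Real.pi, Real.sin ψ ^ 2 * ∏ i, 1 / √(1 - x i * Real.sin ψ ^ 2)) /
        (Real.pi / 2)) := by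
  have h := (hasSum_integral_sin_pow_mul_prod x hx0 hx1 1).div_const (Real.pi / 2)
  simp only [mul_one] at h
  refine h.congr_fun fun n => ?_
  -- The extra sin² shifts the index by one: (1/2)_{N+1} = (1/2)(3/2)_N and (N+1)! = (2)_N. This is
  -- the origin of the parameters 3/2 and 2 and of the factor π/2.
  have h1 : ∀ (N : ℕ) (c : ℝ), (ascPochhammer ℝ (N + 1)).eval c
      = c * (ascPochhammer ℝ N).eval (c + 1) := fun N c => by
    simp [ascPochhammer_succ_left, Polynomial.eval_comp]
  have h2 : ((∑ i, n i + 1).factorial : ℝ) = (ascPochhammer ℝ (∑ i, n i)).eval 2 := by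
    rw [← ascPochhammer_eval_one ℝ, h1]
    norm_num
  rw [integral_sin_pow_even_eq_ascPochhammer, Finset.prod_mul_distrib, Finset.prod_div_distrib,
    lauricellaTerm, h1, h2]
  have := Real.pi_ne_zero
  norm_num
  field_simp

/-! ### Jacobi amplitude and poles of sn -/

lemma ellipticF_zero (k2 : ℝ) : ellipticF k2 0 = 0 := by simp [ellipticF]

lemma ellipticF_jacobiAm {k2 : ℝ} (hk : k2 < 1) (u : ℝ) : ellipticF k2 (jacobiAm k2 u) = u :=
  Function.rightInverse_invFun (ellipticF_bijective hk).surjective u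

lemma jacobiAm_ellipticF {k2 : ℝ} (hk : k2 < 1) (φ : ℝ) : jacobiAm k2 (ellipticF k2 φ) = φ :=
  Function.leftInverse_invFun (ellipticF_bijective hk).injective φ

lemma ellipticF_strictMono {k2 : ℝ} (hk : k2 < 1) : StrictMono (ellipticF k2) := by
  refine strictMono_of_deriv_pos fun φ => ?_
  rw [(ellipticF_hasDerivAt hk φ).deriv]
  have := Real.sqrt_pos.2 (one_sub_mul_sin_sq_pos hk φ)
  positivity

lemma jacobiAm_continuous {k2 : ℝ} (hk : k2 < 1) : Continuous (jacobiAm k2) := by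
  have h : jacobiAm k2 =
      ((ellipticF_strictMono hk).orderIsoOfSurjective _ (ellipticF_bijective hk).surjective).symm := by
    funext u
    apply (ellipticF_bijective hk).injective
    rw [ellipticF_jacobiAm hk]
    exact (((ellipticF_strictMono hk).orderIsoOfSurjective _
      (ellipticF_bijective hk).surjective).apply_symm_apply u).symm
  rw [h]
  exact OrderIso.continuous _

lemma jacobiAm_hasDerivAt {k2 : ℝ} (hk : k2 < 1) (u : ℝ) :
    HasDerivAt (jacobiAm k2) (√(1 - k2 * Real.sin (jacobiAm k2 u) ^ 2)) u := by
  have hs := Real.sqrt_pos.2 (one_sub_mul_sin_sq_pos hk (jacobiAm k2 u))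
  have h := HasDerivAt.of_local_left_inverse (jacobiAm_continuous hk).continuousAt
    (ellipticF_hasDerivAt hk (jacobiAm k2 u)) (by positivity)
    (Eventually.of_forall (ellipticF_jacobiAm hk))
  simpa using h

lemma ellipticF_neg (k2 φ : ℝ) : ellipticF k2 (-φ) = -ellipticF k2 φ := by
  unfold ellipticF
  have h := intervalIntegral.integral_comp_neg (a := 0) (b := φ)
    fun ψ : ℝ => 1 / √(1 - k2 * Real.sin ψ ^ 2)
  simp only [Real.sin_neg, neg_sq, neg_zero] at h
  rw [h, intervalIntegral.integral_symm]

lemma jacobiAm_neg {k2 : ℝ} (hk : k2 < 1) (u : ℝ) : jacobiAm k2 (-u) = -jacobiAm k2 u := by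
  apply (ellipticF_bijective hk).injective
  rw [ellipticF_neg, ellipticF_jacobiAm hk, ellipticF_jacobiAm hk]

lemma ellipticF_add_pi {k2 : ℝ} (hk : k2 < 1) (φ : ℝ) :
    ellipticF k2 (φ + Real.pi) = ellipticF k2 φ + 2 * ellipticK k2 := by
  have hp : Function.Periodic (fun ψ : ℝ => 1 / √(1 - k2 * Real.sin ψ ^ 2)) Real.pi := fun ψ => by
    simp [Real.sin_add_pi]
  have hi := fun a b => (ellipticF_integrand_continuous hk).intervalIntegrable (μ := volume) a b
  have h1 := hp.intervalIntegral_add_eq φ (-(Real.pi / 2))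
  have h2 : ellipticF k2 (φ + Real.pi) - ellipticF k2 φ =
      ∫ ψ in φ..φ + Real.pi, 1 / √(1 - k2 * Real.sin ψ ^ 2) :=
    intervalIntegral.integral_interval_sub_left (hi _ _) (hi _ _)
  have h3 : ellipticF k2 (Real.pi / 2) - ellipticF k2 (-(Real.pi / 2)) =
      ∫ ψ in -(Real.pi / 2)..Real.pi / 2, 1 / √(1 - k2 * Real.sin ψ ^ 2) :=
    intervalIntegral.integral_interval_sub_left (hi _ _) (hi _ _)
  rw [show -(Real.pi / 2) + Real.pi = Real.pi / 2 by ring, ← h2, ← h3, ellipticF_neg] at h1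
  rw [ellipticK]
  linarith

lemma ellipticF_add_int_mul_pi {k2 : ℝ} (hk : k2 < 1) (φ : ℝ) (l : ℤ) :
    ellipticF k2 (φ + l * Real.pi) = ellipticF k2 φ + 2 * l * ellipticK k2 := by
  induction l using Int.induction_on with
  | zero => simp
  | succ n ih =>
    have h := ellipticF_add_pi hk (φ + (n : ℤ) * Real.pi)
    rw [ih] at h
    push_cast at h ⊢
    rw [show φ + (n + 1) * Real.pi = φ + n * Real.pi + Real.pi by ring, h]
    ring
  | pred n ih =>
    have h := ellipticF_add_pi hk (φ + (-(n : ℤ) - 1 : ℤ) * Real.pi)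
    rw [show φ + ((-(n : ℤ) - 1 : ℤ) : ℝ) * Real.pi + Real.pi = φ + ((-(n : ℤ) : ℤ) : ℝ) * Real.pi by
      push_cast; ring, ih] at h
    push_cast at h ⊢
    linarith

/-- On the imaginary axis the poles of `sn (·, k²)` are the zeros of `cn (·, 1 - k²)`. -/
lemma isJacobiSnPole_I_mul_iff {k2 : ℝ} (h0 : 0 < k2) (v : ℝ) :
    IsJacobiSnPole k2 (Complex.I * v) ↔ Real.cos (jacobiAm (1 - k2) v) = 0 := by
  have hk' : 1 - k2 < 1 := by linarith
  have hF : ∀ l : ℤ, ellipticF (1 - k2) ((2 * l + 1) * Real.pi / 2) =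
      (2 * l + 1) * ellipticK (1 - k2) := fun l => by
    rw [show (2 * l + 1) * Real.pi / 2 = Real.pi / 2 + l * Real.pi by ring,
      ellipticF_add_int_mul_pi hk', ← ellipticK]
    ring
  rw [Real.cos_eq_zero_iff]
  constructor
  · rintro ⟨j, l, h⟩
    have h3 := congrArg Complex.im h
    simp at h3
    refine ⟨l, ?_⟩
    rw [← jacobiAm_ellipticF hk' ((2 * l + 1) * Real.pi / 2), hF, h3]
  · rintro ⟨l, h⟩
    refine ⟨0, l, ?_⟩
    have h3 := ellipticF_jacobiAm hk' v
    rw [h, hF] at h3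
    rw [← h3]
    push_cast
    ring

/-! ### Explicit solution of the polar oscillator -/

/-- The even function `cos φ / √(1 - n sin² φ)` of the amplitude `φ = am (c λ, m)` and its
derivative: the solution of `y'' = y P'(y²)`, `y'² = P(y²)` for a cubic polynomial `P`. -/
def polarCos (n m A c l : ℝ) : ℝ :=
  A * Real.cos (jacobiAm m (c * l)) / √(1 - n * Real.sin (jacobiAm m (c * l)) ^ 2)

/-- The factor 1 - n comes from d/dφ (cos φ / D) = -(1 - n) sin φ / D³ with D² = 1 - n sin²φ; the
remaining factor is c times am' = √(1 - m sin²φ). -/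
def polarCosDeriv (n m A c l : ℝ) : ℝ :=
  -(A * (1 - n) * c) * Real.sin (jacobiAm m (c * l)) * √(1 - m * Real.sin (jacobiAm m (c * l)) ^ 2) /
    √(1 - n * Real.sin (jacobiAm m (c * l)) ^ 2) ^ 3

lemma jacobiAm_comp_hasDerivAt {m : ℝ} (hm : m < 1) (c l : ℝ) :
    HasDerivAt (fun l => jacobiAm m (c * l)) (√(1 - m * Real.sin (jacobiAm m (c * l)) ^ 2) * c) l := by
  have h := (jacobiAm_hasDerivAt hm (c * l)).comp l ((hasDerivAt_id l).const_mul c)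
  rwa [mul_one] at h

lemma sqrt_one_sub_mul_sin_sq_hasDerivAt {n : ℝ} (hn : n < 1) {φ : ℝ → ℝ} {φ' l : ℝ}
    (h : HasDerivAt φ φ' l) :
    HasDerivAt (fun l => √(1 - n * Real.sin (φ l) ^ 2))
      (-n * Real.sin (φ l) * Real.cos (φ l) * φ' / √(1 - n * Real.sin (φ l) ^ 2)) l := by
  have h1 := ((h.sin.pow 2).const_mul n).const_sub 1
  have h2 := h1.sqrt (one_sub_mul_sin_sq_pos hn (φ l)).ne'
  refine h2.congr_deriv ?_
  have := Real.sqrt_pos.2 (one_sub_mul_sin_sq_pos hn (φ l))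
  simp only [Pi.pow_apply]
  field_simp
  simp only [Nat.cast_ofNat, Nat.reduceSub, pow_one]
  ring

lemma polarCos_hasDerivAt {n m : ℝ} (hn : n < 1) (hm : m < 1) (A c l : ℝ) :
    HasDerivAt (polarCos n m A c) (polarCosDeriv n m A c l) l := by
  have hφ := jacobiAm_comp_hasDerivAt hm c l
  have hD := sqrt_one_sub_mul_sin_sq_hasDerivAt hn hφ
  have hp := Real.sqrt_pos.2 (one_sub_mul_sin_sq_pos hn (jacobiAm m (c * l)))
  have hq := Real.sq_sqrt (one_sub_mul_sin_sq_pos hn (jacobiAm m (c * l))).le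
  refine ((hφ.cos.const_mul A).div hD hp.ne').congr_deriv ?_
  have hcs := Real.sin_sq_add_cos_sq (jacobiAm m (c * l))
  simp only [polarCosDeriv]
  generalize √(1 - n * Real.sin (jacobiAm m (c * l)) ^ 2) = D at *
  generalize √(1 - m * Real.sin (jacobiAm m (c * l)) ^ 2) = ψ at *
  generalize Real.sin (jacobiAm m (c * l)) = s at *
  generalize Real.cos (jacobiAm m (c * l)) = k at *
  field_simp
  linear_combination A * s * ψ * c * (n * hcs - hq)

/-- The second order equation satisfied by `polarCos`: if
`P(z) = C (z - z₁) (z - z₃) (z - z₂)` with `z₁ < 0 < z₂ < z₃`, then `y'' = y P'(y²)`. -/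
lemma polarCosDeriv_hasDerivAt {C z₁ z₂ z₃ : ℝ} (hC : 0 < C) (h₁ : z₁ < 0) (h₂ : 0 < z₂)
    (h₃ : z₂ < z₃) {n m A c : ℝ} (hn : n = z₂ / z₃) (hm : m = z₂ * (z₃ - z₁) / (z₃ * (z₂ - z₁)))
    (hA : A ^ 2 = z₂) (hc : c ^ 2 = C * (z₂ - z₁) * z₃) (hn1 : n < 1) (hm1 : m < 1) (l : ℝ) :
    HasDerivAt (polarCosDeriv n m A c)
      (polarCos n m A c l * (C * ((polarCos n m A c l ^ 2 - z₃) * (polarCos n m A c l ^ 2 - z₂) +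
        (polarCos n m A c l ^ 2 - z₁) * (polarCos n m A c l ^ 2 - z₂) +
        (polarCos n m A c l ^ 2 - z₁) * (polarCos n m A c l ^ 2 - z₃)))) l := by
  have hφ := jacobiAm_comp_hasDerivAt hm1 c l
  have hD := sqrt_one_sub_mul_sin_sq_hasDerivAt hn1 hφ
  have hψ := sqrt_one_sub_mul_sin_sq_hasDerivAt hm1 hφ
  have hp := Real.sqrt_pos.2 (one_sub_mul_sin_sq_pos hn1 (jacobiAm m (c * l)))
  have hp' := Real.sqrt_pos.2 (one_sub_mul_sin_sq_pos hm1 (jacobiAm m (c * l)))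
  have hq := Real.sq_sqrt (one_sub_mul_sin_sq_pos hn1 (jacobiAm m (c * l))).le
  have hq' := Real.sq_sqrt (one_sub_mul_sin_sq_pos hm1 (jacobiAm m (c * l))).le
  refine (((hφ.sin.const_mul (-(A * (1 - n) * c))).mul hψ).div (hD.pow 3)
    (pow_pos hp 3).ne').congr_deriv ?_
  have hcs := Real.sin_sq_add_cos_sq (jacobiAm m (c * l))
  simp only [polarCos, Pi.pow_apply, Pi.mul_apply, Nat.cast_ofNat, Nat.reduceSub]
  generalize √(1 - n * Real.sin (jacobiAm m (c * l)) ^ 2) = D at *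
  generalize √(1 - m * Real.sin (jacobiAm m (c * l)) ^ 2) = ψ at *
  generalize Real.sin (jacobiAm m (c * l)) = s at *
  generalize Real.cos (jacobiAm m (c * l)) = k at *
  have hz3 : 0 < z₃ := h₂.trans h₃
  have hz21 : 0 < z₂ - z₁ := by linarith
  have hy : (A * k / D) ^ 2 = z₂ * (1 - s ^ 2) / D ^ 2 := by
    rw [div_pow, mul_pow, hA]
    congr 2
    linarith
  -- Each factor of P(y²) becomes a simple multiple of 1/D². The parameter n makes the factor at z₃
  -- constant over D², and m is the value for which the factor at z₁ is proportional to ψ².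
  have e1 : (A * k / D) ^ 2 - z₁ = (z₂ - z₁) * ψ ^ 2 / D ^ 2 := by
    rw [hy, hq']
    field_simp
    rw [hq, hm, hn]
    field_simp
    ring
  have e2 : (A * k / D) ^ 2 - z₂ = -(z₂ * (1 - n) * s ^ 2) / D ^ 2 := by
    rw [hy]
    field_simp
    rw [hq]
    ring
  have e3 : (A * k / D) ^ 2 - z₃ = -(z₃ - z₂) / D ^ 2 := by
    rw [hy]
    field_simp
    rw [hq, hn]
    field_simp
    ring
  rw [e1, e2, e3]
  -- What remains after removing the common factor in A, k, D and C: a polynomial identity in s²,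
  -- once D² and ψ² are expanded.
  have key : (1 - n) * ((z₂ - z₁) * z₃) *
      (ψ ^ 2 * D ^ 2 - m * s ^ 2 * D ^ 2 + 3 * n * s ^ 2 * ψ ^ 2) =
      -((z₃ - z₂) * (z₂ * (1 - n) * s ^ 2) - (z₂ - z₁) * ψ ^ 2 * (z₂ * (1 - n) * s ^ 2)
        - (z₂ - z₁) * ψ ^ 2 * (z₃ - z₂)) := by
    rw [hq, hq', hm, hn]
    field_simp
    ring
  have hl : (-(A * (1 - n) * c) * (k * (ψ * c)) * ψ
      + -(A * (1 - n) * c) * s * (-m * s * k * (ψ * c) / ψ)) * D ^ 3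
      - -(A * (1 - n) * c) * s * ψ * (3 * D ^ 2 * (-n * s * k * (ψ * c) / D)) =
      -(A * k * D * (1 - n) * c ^ 2 *
        (ψ ^ 2 * D ^ 2 - m * s ^ 2 * D ^ 2 + 3 * n * s ^ 2 * ψ ^ 2)) := by
    field_simp
    ring
  have hr : ∀ X : ℝ, -(A * k * D * (1 - n) * (C * (z₂ - z₁) * z₃) * X) =
      -(A * k * D * C) * ((1 - n) * ((z₂ - z₁) * z₃) * X) := fun X => by ring
  rw [hl, hc, hr, key]
  field_simp
  ring

/-! ### The radial integral -/

/-- The Möbius image of a root: with `t = (rA - r) / (ω (r₁ - r))`, the factor `1 - x t` belonging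
to `x = ω (r₁ - γ) / (rA - γ)`. -/
lemma one_sub_crossRatio_mul {r₁ rA γ ω r : ℝ} (h1 : rA < r₁) (hγ : γ < rA) (hω : 0 < ω)
    (hr : r < r₁) :
    1 - ω * ((r₁ - γ) / (rA - γ)) * ((rA - r) / (ω * (r₁ - r))) =
      (r - γ) * (r₁ - rA) / ((rA - γ) * (r₁ - r)) := by
  have := sub_pos.2 h1
  have := sub_pos.2 hγ
  have := sub_pos.2 hr
  field_simp
  ring

/-- The upper bound rests on (r₁ - rP)(rA - γ) - (rA - rP)(r₁ - γ) = (r₁ - rA)(rP - γ) > 0. It is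
what puts the Lauricella series inside their domain of convergence. -/
lemma crossRatio_mem {r₁ rA rP γ : ℝ} (h1 : rA < r₁) (hAP : rP < rA) (hγ : γ < rP) :
    0 ≤ (rA - rP) / (r₁ - rP) * ((r₁ - γ) / (rA - γ)) ∧
      (rA - rP) / (r₁ - rP) * ((r₁ - γ) / (rA - γ)) < 1 := by
  have h2 : 0 < rA - rP := by linarith
  have h3 : 0 < r₁ - rP := by linarith
  have h4 : 0 < r₁ - γ := by linarith
  have h5 : 0 < rA - γ := by linarith
  refine ⟨by positivity, ?_⟩
  rw [div_mul_div_comm, div_lt_one (by positivity)]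
  nlinarith [mul_pos (sub_pos.2 h1) (sub_pos.2 hγ)]

/-- Reflection ψ ↦ π - ψ. The substitution yields a quarter period, whereas the series are expressed
over [0, π]. -/
lemma integral_comp_sin_sq_zero_pi {f : ℝ → ℝ} (hf : Continuous fun ψ => f (Real.sin ψ ^ 2)) :
    ∫ ψ in (0 : ℝ)..Real.pi, f (Real.sin ψ ^ 2) =
      2 * ∫ ψ in (0 : ℝ)..Real.pi / 2, f (Real.sin ψ ^ 2) := by
  have h := intervalIntegral.integral_comp_sub_left (a := 0) (b := Real.pi / 2)
    (fun ψ => f (Real.sin ψ ^ 2)) Real.pi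
  simp only [Real.sin_pi_sub, sub_zero] at h
  rw [show Real.pi - Real.pi / 2 = Real.pi / 2 by ring] at h
  rw [← intervalIntegral.integral_add_adjacent_intervals (b := Real.pi / 2)
    (hf.intervalIntegrable _ _) (hf.intervalIntegrable _ _), ← h]
  ring

/-- An antiderivative of `1 / √R` for a sextic `R` with real roots, between the roots `rP < rA`,
obtained by the substitution `sin² ψ = (rA - r) / (ω (r₁ - r))`. -/
lemma exists_antideriv_one_div_sqrt_sextic {l r₁ rA rP : ℝ} (hl : 0 < l) (h1 : rA < r₁)
    (hAP : rP < rA) {γ : Fin 3 → ℝ} (hγ : ∀ i, γ i < rP) :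
    let ω := (rA - rP) / (r₁ - rP)
    ∃ G : ℝ → ℝ, ContinuousOn G (Icc rP rA) ∧
      (∀ r ∈ Ioo rP rA, HasDerivAt G
        (1 / √(l * ((r - r₁) * (r - rA) * (r - rP) * (r - γ 0) * (r - γ 1) * (r - γ 2)))) r) ∧
      G rA - G rP = √ω / (√l * √((rA - rP) * (rA - γ 0) * (rA - γ 1) * (rA - γ 2))) *
        ∫ ψ in (0 : ℝ)..Real.pi, (1 - ω * Real.sin ψ ^ 2) *
          ∏ i, 1 / √(1 - ω * ((r₁ - γ i) / (rA - γ i)) * Real.sin ψ ^ 2) := by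
  intro ω
  have h1P : 0 < r₁ - rP := by linarith
  have hAP' : 0 < rA - rP := by linarith
  have hω : 0 < ω := by positivity
  have hγA : ∀ i, 0 < rA - γ i := fun i => by linarith [hγ i]
  set H := √((rA - rP) * (rA - γ 0) * (rA - γ 1) * (rA - γ 2)) with hH
  have hH2 : H ^ 2 = (rA - rP) * (rA - γ 0) * (rA - γ 1) * (rA - γ 2) :=
    Real.sq_sqrt (by have := hγA 0; have := hγA 1; have := hγA 2; positivity)
  have hHpos : 0 < H :=
    Real.sqrt_pos.2 (by have := hγA 0; have := hγA 1; have := hγA 2; positivity)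
  set C := √ω / (√l * H) with hC
  have hCpos : 0 < C := by positivity
  have hC2 : C ^ 2 = ω / (l * H ^ 2) := by
    rw [hC, div_pow, mul_pow, Real.sq_sqrt hω.le, Real.sq_sqrt hl.le]
  clear_value C
  set f : ℝ → ℝ := fun s => (1 - ω * s) * ∏ i, 1 / √(1 - ω * ((r₁ - γ i) / (rA - γ i)) * s)
    with hf
  have hfc : Continuous fun ψ => f (Real.sin ψ ^ 2) :=
    (by fun_prop : Continuous fun ψ : ℝ => 1 - ω * Real.sin ψ ^ 2).mul
      (continuous_finsetProd _ fun i _ =>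
        ellipticF_integrand_continuous (crossRatio_mem h1 hAP (hγ i)).2)
  have hJ : ∀ ψ, HasDerivAt (fun ψ => ∫ s in (0 : ℝ)..ψ, f (Real.sin s ^ 2))
      (f (Real.sin ψ ^ 2)) ψ := fun ψ => (hfc.integral_hasStrictDerivAt 0 ψ).hasDerivAt
  -- The Möbius map sending rA to 0, rP to 1 and r₁ to infinity, so that 1 - t vanishes at rP and
  -- the other three roots give the factors 1 - xᵢ t.
  set t : ℝ → ℝ := fun r => (rA - r) / (ω * (r₁ - r)) with ht
  have htP : t rP = 1 := by
    simp only [ht, ω]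
    field_simp
  have htA : t rA = 0 := by simp [ht]
  -- The minus sign compensates for t decreasing in r; the 2 comes from t = sin²ψ ranging over a
  -- quarter period only.
  refine ⟨fun r => -(2 * C) * ∫ s in (0 : ℝ)..Real.arcsin √(t r), f (Real.sin s ^ 2),
    ?_, fun r hr => ?_, ?_⟩
  · have hJc : Continuous fun ψ => ∫ s in (0 : ℝ)..ψ, f (Real.sin s ^ 2) :=
      continuous_iff_continuousAt.2 fun ψ => (hJ ψ).continuousAt
    have htc : ContinuousOn t (Icc rP rA) := by
      refine ContinuousOn.div (by fun_prop) (by fun_prop) fun r hr => ?_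
      have : 0 < r₁ - r := by linarith [hr.2]
      positivity
    exact continuousOn_const.mul
      ((hJc.comp (Real.continuous_arcsin.comp Real.continuous_sqrt)).comp_continuousOn htc)
  · have hrA : 0 < rA - r := by linarith [hr.2]
    have hrP : 0 < r - rP := by linarith [hr.1]
    have hr1 : 0 < r₁ - r := by linarith [hr.2]
    have h1A : 0 < r₁ - rA := by linarith
    have hrγ : ∀ i, 0 < r - γ i := fun i => by linarith [hγ i]
    have ht0 : 0 < t r := by positivity
    have h1t : 1 - t r = (r - rP) * (r₁ - rA) / ((rA - rP) * (r₁ - r)) := by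
      simp only [ht, ω]
      field_simp
      ring
    have h1t' : 0 < 1 - t r := by rw [h1t]; positivity
    have hωt : 1 - ω * t r = (r₁ - rA) / (r₁ - r) := by
      simp only [ht]
      field_simp
      ring
    have ht' : HasDerivAt t (-(r₁ - rA) / (ω * (r₁ - r) ^ 2)) r := by
      refine (((hasDerivAt_id r).const_sub rA).div
        (((hasDerivAt_id r).const_sub r₁).const_mul ω) (mul_pos hω hr1).ne').congr_deriv ?_
      simp only [id]
      field_simp
      ring
    have hs1 : √(t r) < 1 := by
      rw [Real.sqrt_lt' one_pos]
      linarith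
    have hs0 : 0 < √(t r) := Real.sqrt_pos.2 ht0
    have hψ := (Real.hasDerivAt_arcsin (by linarith) hs1.ne).comp r (ht'.sqrt ht0.ne')
    have hG := ((hJ _).comp r hψ).const_mul (-(2 * C))
    refine hG.congr_deriv ?_
    simp only [Function.comp_apply]
    rw [Real.sin_arcsin (by linarith) hs1.le, Real.sq_sqrt ht0.le]
    have hx : ∀ i, 1 - ω * ((r₁ - γ i) / (rA - γ i)) * t r =
        (r - γ i) * (r₁ - rA) / ((rA - γ i) * (r₁ - r)) := fun i =>
      one_sub_crossRatio_mul h1 (by linarith [hγ i]) hω (by linarith)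
    have hfpos : 0 < f (t r) := by
      simp only [hf, hx, hωt]
      refine mul_pos (by positivity) (Finset.prod_pos fun i _ => ?_)
      have := hrγ i
      have := hγA i
      have : 0 < (r - γ i) * (r₁ - rA) / ((rA - γ i) * (r₁ - r)) := by positivity
      positivity
    have hf2 : f (t r) ^ 2 = ((r₁ - rA) / (r₁ - r)) ^ 2 *
        ∏ i, ((rA - γ i) * (r₁ - r)) / ((r - γ i) * (r₁ - rA)) := by
      simp only [hf, hx, hωt]
      rw [mul_pow, ← Finset.prod_pow]
      congr 1
      refine Finset.prod_congr rfl fun i _ => ?_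
      have := hrγ i
      have := hγA i
      rw [div_pow, one_pow, Real.sq_sqrt (by positivity), one_div_div]
    have hR : l * ((r - r₁) * (r - rA) * (r - rP) * (r - γ 0) * (r - γ 1) * (r - γ 2)) =
        l * ((r₁ - r) * (rA - r) * (r - rP) * (r - γ 0) * (r - γ 1) * (r - γ 2)) := by ring
    have h0 := hrγ 0
    have h1' := hrγ 1
    have h2 := hrγ 2
    have h0A := hγA 0
    have h1A' := hγA 1
    have h2A := hγA 2
    have hlhs : -(2 * C) * (f (t r) * (1 / √(1 - t r) *
        (-(r₁ - rA) / (ω * (r₁ - r) ^ 2) / (2 * √(t r))))) =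
        C * f (t r) * (r₁ - rA) / (ω * (r₁ - r) ^ 2 * √(1 - t r) * √(t r)) := by
      have := Real.sqrt_pos.2 h1t'
      field_simp
    have hRpos : 0 < l * ((r₁ - r) * (rA - r) * (r - rP) * (r - γ 0) * (r - γ 1) * (r - γ 2)) := by
      positivity
    have hs1t := Real.sqrt_pos.2 h1t'
    have hsq : ∀ y u v : ℝ, (C * y * (r₁ - rA) / (ω * (r₁ - r) ^ 2 * u * v)) ^ 2 =
        C ^ 2 * y ^ 2 * (r₁ - rA) ^ 2 / (ω ^ 2 * (r₁ - r) ^ 4 * u ^ 2 * v ^ 2) := fun y u v => by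
      rw [div_pow]
      congr 1 <;> ring
    -- Both sides are positive, so it suffices to compare squares; this removes all square roots and
    -- leaves a rational identity.
    rw [hlhs, hR, ← sq_eq_sq₀ (by positivity) (by positivity), hsq, one_div_pow, Real.sq_sqrt hRpos.le, Real.sq_sqrt ht0.le, Real.sq_sqrt h1t'.le, hC2, hf2,
      hH2, h1t, Fin.prod_univ_three]
    simp only [ht]
    field_simp
  · simp only [htP, htA, Real.sqrt_zero, Real.arcsin_zero, Real.sqrt_one, Real.arcsin_one,
      intervalIntegral.integral_same]
    have h := integral_comp_sin_sq_zero_pi hfc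
    simp only [hf] at h ⊢
    rw [h]
    ring

/-- The complete hyperelliptic integral in terms of Lauricella's functions `F_D`. -/
lemma integral_one_sub_mul_prod_eq_lauricella {m : ℕ} (ω : ℝ) (x : Fin m → ℝ)
    (hx0 : ∀ i, 0 ≤ x i) (hx1 : ∀ i, x i < 1) :
    ∫ ψ in (0 : ℝ)..Real.pi, (1 - ω * Real.sin ψ ^ 2) * ∏ i, 1 / √(1 - x i * Real.sin ψ ^ 2) =
      lauricellaFD (1 / 2) (fun _ => 1 / 2) 1 x * Real.pi -
        ω * lauricellaFD (3 / 2) (fun _ => 1 / 2) 2 x * (Real.pi / 2) := by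
  have hp : Continuous fun ψ : ℝ => ∏ i, 1 / √(1 - x i * Real.sin ψ ^ 2) :=
    continuous_finsetProd _ fun i _ => ellipticF_integrand_continuous (hx1 i)
  have hp2 : Continuous fun ψ : ℝ => ω * (Real.sin ψ ^ 2 * ∏ i, 1 / √(1 - x i * Real.sin ψ ^ 2)) :=
    continuous_const.mul ((by fun_prop : Continuous fun ψ : ℝ => Real.sin ψ ^ 2).mul hp)
  rw [lauricellaFD, lauricellaFD, (hasSum_lauricellaTerm_half_one x hx0 hx1).tsum_eq,
    (hasSum_lauricellaTerm_three_half_two x hx0 hx1).tsum_eq]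
  have hpi := Real.pi_ne_zero
  rw [div_mul_cancel₀ _ hpi, mul_assoc, div_mul_cancel₀ _ (by positivity),
    ← intervalIntegral.integral_const_mul, ← intervalIntegral.integral_sub
      (hp.intervalIntegrable _ _) (hp2.intervalIntegrable _ _)]
  congr 1
  funext ψ
  ring

/-! ### Conserved quantities and the separated equations -/

namespace KNdS

variable {p : KNdS} {X : ℝ → Fin 4 → ℝ} {I : Set ℝ}

lemma Xi_pos (hΛ : 0 < p.Λ) : 0 < p.Xi := by
  unfold Xi
  positivity

lemma deltaTheta_pos (hΛ : 0 < p.Λ) (θ : ℝ) : 0 < p.deltaTheta θ := by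
  unfold deltaTheta
  positivity

/-- The conjugate momentum of `θ`, up to the factor `-1 / Δ_θ`: `ρ² dθ/dτ`. -/
def polarMomentum (p : KNdS) (X : ℝ → Fin 4 → ℝ) (τ : ℝ) : ℝ :=
  p.rhoSq (X τ 1) (X τ 2) * deriv X τ 2

lemma energy_eq (x u : Fin 4 → ℝ) : p.energy x u =
    p.deltaR (x 1) / (p.Xi ^ 2 * p.rhoSq (x 1) (x 2)) * (u 0 - p.a * Real.sin (x 2) ^ 2 * u 3) -
    p.deltaTheta (x 2) * Real.sin (x 2) ^ 2 / (p.Xi ^ 2 * p.rhoSq (x 1) (x 2)) *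
      (p.a * u 0 - (x 1 ^ 2 + p.a ^ 2) * u 3) * p.a := by
  simp [energy, metric]

lemma angularMomentum_eq (x u : Fin 4 → ℝ) : p.angularMomentum x u =
    p.deltaR (x 1) / (p.Xi ^ 2 * p.rhoSq (x 1) (x 2)) * (u 0 - p.a * Real.sin (x 2) ^ 2 * u 3) *
      (p.a * Real.sin (x 2) ^ 2) -
    p.deltaTheta (x 2) * Real.sin (x 2) ^ 2 / (p.Xi ^ 2 * p.rhoSq (x 1) (x 2)) *
      (p.a * u 0 - (x 1 ^ 2 + p.a ^ 2) * u 3) * (x 1 ^ 2 + p.a ^ 2) := by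
  simp [angularMomentum, metric]
  ring

lemma metric_single_two (x u : Fin 4 → ℝ) : p.metric x u (Pi.single 2 1) =
    -(p.rhoSq (x 1) (x 2) / p.deltaTheta (x 2) * u 2) := by
  simp [metric]

/-- Inversion of the definitions of `E` and `L` on polar orbits (`L = 0`). -/
lemma deltaR_mul_of_polar {x u : Fin 4 → ℝ} {E : ℝ} (hXi : 0 < p.Xi)
    (hS : 0 < p.rhoSq (x 1) (x 2)) (hE : p.energy x u = E) (hL : p.angularMomentum x u = 0) :
    p.deltaR (x 1) * (u 0 - p.a * Real.sin (x 2) ^ 2 * u 3) =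
        p.Xi ^ 2 * ((x 1 ^ 2 + p.a ^ 2) * E) ∧
      Real.sin (x 2) * (p.deltaTheta (x 2) * (p.a * u 0 - (x 1 ^ 2 + p.a ^ 2) * u 3)) =
        Real.sin (x 2) * (p.Xi ^ 2 * (p.a * E)) := by
  rw [energy_eq] at hE
  rw [angularMomentum_eq] at hL
  have hS' : p.rhoSq (x 1) (x 2) = x 1 ^ 2 + p.a ^ 2 - p.a ^ 2 * Real.sin (x 2) ^ 2 := by
    rw [rhoSq, Real.cos_sq']
    ring
  generalize p.a * u 0 - (x 1 ^ 2 + p.a ^ 2) * u 3 = B at *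
  generalize u 0 - p.a * Real.sin (x 2) ^ 2 * u 3 = A at *
  generalize p.deltaR (x 1) = dR at *
  generalize p.deltaTheta (x 2) = dT at *
  generalize p.rhoSq (x 1) (x 2) = S at *
  generalize Real.sin (x 2) = s at *
  generalize p.Xi = Ξ at *
  have h1 : dR * A - dT * s ^ 2 * B * p.a = Ξ ^ 2 * S * E := by
    rw [← hE]
    field_simp
  have h2 : dR * A * (p.a * s ^ 2) - dT * s ^ 2 * B * (x 1 ^ 2 + p.a ^ 2) = 0 := by
    have : dR * A * (p.a * s ^ 2) - dT * s ^ 2 * B * (x 1 ^ 2 + p.a ^ 2) = Ξ ^ 2 * S *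
        (dR / (Ξ ^ 2 * S) * A * (p.a * s ^ 2) - dT * s ^ 2 / (Ξ ^ 2 * S) * B *
          (x 1 ^ 2 + p.a ^ 2)) := by field_simp
    rw [this, hL, mul_zero]
  refine ⟨?_, ?_⟩
  -- `h1` and `h2` form a linear system for dR * A and dT * s² * B whose determinant is -S.
  · apply mul_left_cancel₀ hS.ne'
    linear_combination (x 1 ^ 2 + p.a ^ 2) * h1 - p.a * h2 + dR * A * hS'
  · have h3 : s ^ 2 * (dT * B) = s ^ 2 * (Ξ ^ 2 * (p.a * E)) := by
      apply mul_left_cancel₀ hS.ne'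
      linear_combination p.a * s ^ 2 * h1 - h2 + s ^ 2 * dT * B * hS'
    -- Only one factor s is cancelled: on the axis B is not determined by E and L, but both sides
    -- vanish.
    rcases eq_or_ne s 0 with h0 | h0
    · rw [h0, zero_mul, zero_mul]
    · rw [mul_left_cancel₀ (pow_ne_zero 2 h0) h3]

/-- The term in (a U^t - (r² + a²) U^φ)² contains the square of sin θ times the quantity fixed by E
when L = 0. Hence U^t and U^φ drop out, on the axis too. -/
lemma killingTensor_mul_deltaTheta {x u : Fin 4 → ℝ} {E : ℝ} (hΛ : 0 < p.Λ)
    (hS : 0 < p.rhoSq (x 1) (x 2)) (hE : p.energy x u = E) (hL : p.angularMomentum x u = 0)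
    (hg : p.metric x u u = 1) :
    p.killingTensor x u = ((p.rhoSq (x 1) (x 2) * u 2) ^ 2 +
      p.Xi ^ 2 * p.a ^ 2 * E ^ 2 * Real.sin (x 2) ^ 2) / p.deltaTheta (x 2) +
        p.a ^ 2 * Real.cos (x 2) ^ 2 := by
  have hXi := p.Xi_pos hΛ
  have hT := p.deltaTheta_pos hΛ (x 2)
  obtain ⟨-, h2⟩ := deltaR_mul_of_polar hXi hS hE hL
  rw [killingTensor, hg]
  have h3 : p.deltaTheta (x 2) * Real.sin (x 2) ^ 2 / p.Xi ^ 2 *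
      (p.a * u 0 - (x 1 ^ 2 + p.a ^ 2) * u 3) ^ 2 =
      (Real.sin (x 2) * (p.deltaTheta (x 2) * (p.a * u 0 - (x 1 ^ 2 + p.a ^ 2) * u 3))) ^ 2 /
        (p.Xi ^ 2 * p.deltaTheta (x 2)) := by
    field_simp
  rw [h3, h2]
  field_simp

/-- The radial equation `ρ⁴ (dr/dτ)² = R'(r)`. -/
lemma rhoSq_mul_radial_sq {x u : Fin 4 → ℝ} {E Q : ℝ} (hΛ : 0 < p.Λ)
    (hR : 0 < p.deltaR (x 1)) (hS : 0 < p.rhoSq (x 1) (x 2)) (hE : p.energy x u = E)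
    (hL : p.angularMomentum x u = 0) (hg : p.metric x u u = 1)
    (hK : p.killingTensor x u = Q + p.Xi ^ 2 * p.a ^ 2 * E ^ 2) :
    (p.rhoSq (x 1) (x 2) * u 1) ^ 2 = p.radialR E 0 Q (x 1) := by
  have hXi := p.Xi_pos hΛ
  have hT := p.deltaTheta_pos hΛ (x 2)
  obtain ⟨h1, -⟩ := deltaR_mul_of_polar hXi hS hE hL
  rw [killingTensor, hg] at hK
  rw [metric] at hg
  have hS' : p.rhoSq (x 1) (x 2) = x 1 ^ 2 + p.a ^ 2 * Real.cos (x 2) ^ 2 := rfl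
  rw [radialR]
  generalize p.a * u 0 - (x 1 ^ 2 + p.a ^ 2) * u 3 = B at *
  generalize u 0 - p.a * Real.sin (x 2) ^ 2 * u 3 = A at *
  generalize p.deltaR (x 1) = dR at *
  generalize p.deltaTheta (x 2) = dT at *
  generalize p.rhoSq (x 1) (x 2) = S at *
  generalize Real.sin (x 2) = s at *
  generalize Real.cos (x 2) = c at *
  generalize p.Xi = Ξ at *
  -- The normalisation multiplied by dR * S isolates the radial velocity; the θ and B terms then
  -- regroup into the Killing value minus a² cos²θ.
  have h3 : (S * u 1) ^ 2 = (dR * A) ^ 2 / Ξ ^ 2 -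
      dR * (S ^ 2 * u 2 ^ 2 / dT + dT * s ^ 2 / Ξ ^ 2 * B ^ 2) - dR * S *
      (dR / (Ξ ^ 2 * S) * A * A - S / dR * u 1 * u 1 - S / dT * u 2 * u 2 -
        dT * s ^ 2 / (Ξ ^ 2 * S) * B * B) := by
    field_simp
    ring
  have h4 : S ^ 2 * u 2 ^ 2 / dT + dT * s ^ 2 / Ξ ^ 2 * B ^ 2 =
      Q + Ξ ^ 2 * p.a ^ 2 * E ^ 2 - p.a ^ 2 * c ^ 2 := by linarith
  rw [h3, hg, h4, h1, hS']
  field_simp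
  ring

/-- The `θ` derivative of `g(u, u)`. -/
lemma metric_update_two_hasDerivAt (hΛ : 0 < p.Λ) {x u : Fin 4 → ℝ}
    (hS : 0 < p.rhoSq (x 1) (x 2)) :
    HasDerivAt (fun h => p.metric (Function.update x 2 h) u u)
      (p.deltaR (x 1) / p.Xi ^ 2 * (2 * p.a ^ 2 * Real.sin (x 2) * Real.cos (x 2) /
          p.rhoSq (x 1) (x 2) ^ 2 * (u 0 - p.a * Real.sin (x 2) ^ 2 * u 3) ^ 2 -
          4 * p.a * Real.sin (x 2) * Real.cos (x 2) * u 3 / p.rhoSq (x 1) (x 2) *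
            (u 0 - p.a * Real.sin (x 2) ^ 2 * u 3))
        + 2 * p.a ^ 2 * Real.sin (x 2) * Real.cos (x 2) / p.deltaR (x 1) * u 1 ^ 2
        + (2 * p.a ^ 2 * Real.sin (x 2) * Real.cos (x 2) / p.deltaTheta (x 2)
          - p.rhoSq (x 1) (x 2) * (2 * (p.a ^ 2 * p.Λ / 3) * Real.sin (x 2) * Real.cos (x 2)) /
            p.deltaTheta (x 2) ^ 2) * u 2 ^ 2
        - ((-(2 * (p.a ^ 2 * p.Λ / 3) * Real.sin (x 2) * Real.cos (x 2)) * Real.sin (x 2) ^ 2 +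
            p.deltaTheta (x 2) * (2 * Real.sin (x 2) * Real.cos (x 2))) / p.rhoSq (x 1) (x 2) +
          p.deltaTheta (x 2) * Real.sin (x 2) ^ 2 *
            (2 * p.a ^ 2 * Real.sin (x 2) * Real.cos (x 2)) / p.rhoSq (x 1) (x 2) ^ 2) / p.Xi ^ 2 *
          (p.a * u 0 - (x 1 ^ 2 + p.a ^ 2) * u 3) ^ 2) (x 2) := by
  have hXi := p.Xi_pos hΛ
  have hT := p.deltaTheta_pos hΛ (x 2)
  have hfun : (fun h => p.metric (Function.update x 2 h) u u) = fun h =>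
      p.deltaR (x 1) / p.Xi ^ 2 * ((u 0 - p.a * Real.sin h ^ 2 * u 3) ^ 2 / p.rhoSq (x 1) h)
      - p.rhoSq (x 1) h * (u 1 ^ 2 / p.deltaR (x 1))
      - p.rhoSq (x 1) h / p.deltaTheta h * u 2 ^ 2
      - p.deltaTheta h * Real.sin h ^ 2 / p.rhoSq (x 1) h *
        ((p.a * u 0 - (x 1 ^ 2 + p.a ^ 2) * u 3) ^ 2 / p.Xi ^ 2) := by
    funext h
    simp only [metric, Function.update_self, Function.update_of_ne (show (1 : Fin 4) ≠ 2 by decide)]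
    simp only [div_eq_mul_inv, mul_inv]
    ring
  rw [hfun]
  have hs := (Real.hasDerivAt_sin (x 2)).pow 2
  have hc := (Real.hasDerivAt_cos (x 2)).pow 2
  have hrho : HasDerivAt (fun h => p.rhoSq (x 1) h)
      (-(2 * p.a ^ 2 * Real.sin (x 2) * Real.cos (x 2))) (x 2) := by
    refine ((hc.const_mul (p.a ^ 2)).const_add (x 1 ^ 2)).congr_deriv ?_
    simp
    ring
  have hdT : HasDerivAt p.deltaTheta
      (-(2 * (p.a ^ 2 * p.Λ / 3) * Real.sin (x 2) * Real.cos (x 2))) (x 2) := by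
    refine ((hc.const_mul (p.a ^ 2 * p.Λ / 3)).const_add 1).congr_deriv ?_
    simp
    ring
  have hA := ((((hs.const_mul p.a).mul_const (u 3)).const_sub (u 0)).pow 2).div hrho hS.ne'
  refine ((((hA.const_mul (p.deltaR (x 1) / p.Xi ^ 2)).sub (hrho.mul_const _)).sub
    ((hrho.div hdT hT.ne').mul_const (u 2 ^ 2))).sub
    (((hdT.mul hs).div hrho hS.ne').mul_const _)).congr_deriv ?_
  simp only [Pi.pow_apply, Pi.mul_apply, Nat.cast_ofNat, Nat.reduceSub, pow_one]
  generalize p.deltaTheta (x 2) = dT at *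
  generalize p.rhoSq (x 1) (x 2) = S at *
  generalize Real.sin (x 2) = s at *
  generalize Real.cos (x 2) = c at *
  generalize p.deltaR (x 1) = dR at *
  generalize p.Xi = Ξ at *
  field_simp
  ring

/-- The algebra behind the `θ` component of the geodesic equation. -/
lemma polar_force_algebra {a l dR dT Ξ S s c A B u₁ u₂ u₃ E : ℝ} (hT : dT ≠ 0)
    (hΞ : Ξ ≠ 0) (hS : S ≠ 0)
    (hg : dR / (Ξ ^ 2 * S) * A * A - S / dR * u₁ * u₁ - S / dT * u₂ * u₂ -
      dT * s ^ 2 / (Ξ ^ 2 * S) * B * B = 1)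
    (hu : u₃ * S = a * A - B) (hE : dR * A - dT * s ^ 2 * B * a = Ξ ^ 2 * S * E)
    (hB : s * (dT * B) = s * (Ξ ^ 2 * (a * E))) :
    S * (2 * l * s * c * S * u₂ ^ 2 / dT * (-1) - dT * (1 / 2 *
      (dR / Ξ ^ 2 * (2 * a ^ 2 * s * c / S ^ 2 * A ^ 2 - 4 * a * s * c * u₃ / S * A)
        + 2 * a ^ 2 * s * c / dR * u₁ ^ 2
        + (2 * a ^ 2 * s * c / dT - S * (2 * l * s * c) / dT ^ 2) * u₂ ^ 2
        - ((-(2 * l * s * c) * s ^ 2 + dT * (2 * s * c)) / S +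
          dT * s ^ 2 * (2 * a ^ 2 * s * c) / S ^ 2) / Ξ ^ 2 * B ^ 2))) =
      s * c * (a ^ 2 * dT - l * (((S * u₂) ^ 2 + Ξ ^ 2 * a ^ 2 * E ^ 2 * s ^ 2) / dT)
        - Ξ ^ 2 * a ^ 2 * E ^ 2) := by
  have hu' : u₃ = (a * A - B) / S := by field_simp; exact hu
  have hE' : E = (dR * A - dT * s ^ 2 * B * a) / (Ξ ^ 2 * S) := by rw [hE]; field_simp
  -- The normalisation eliminates the radial velocity from the θ force, which is why no r-dependence
  -- survives on the right.
  have hq : u₁ ^ 2 / dR = (dR / (Ξ ^ 2 * S) * A * A - S / dT * u₂ * u₂ -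
      dT * s ^ 2 / (Ξ ^ 2 * S) * B * B - 1) / S := by
    rw [eq_div_iff hS]
    linear_combination -hg
  have h1 : S * (dR / Ξ ^ 2 * (2 * a ^ 2 * s * c / S ^ 2 * A ^ 2 - 4 * a * s * c * u₃ / S * A)
        + 2 * a ^ 2 * s * c / dR * u₁ ^ 2
        + (2 * a ^ 2 * s * c / dT - S * (2 * l * s * c) / dT ^ 2) * u₂ ^ 2
        - ((-(2 * l * s * c) * s ^ 2 + dT * (2 * s * c)) / S +
          dT * s ^ 2 * (2 * a ^ 2 * s * c) / S ^ 2) / Ξ ^ 2 * B ^ 2) =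
      4 * a * s * c * B * E - 2 * a ^ 2 * s * c - S ^ 2 * u₂ ^ 2 * (2 * l * s * c) / dT ^ 2
        - (-(2 * l * s * c) * s ^ 2 + dT * (2 * s * c)) * B ^ 2 / Ξ ^ 2 := by
    rw [show 2 * a ^ 2 * s * c / dR * u₁ ^ 2 = 2 * a ^ 2 * s * c * (u₁ ^ 2 / dR) by ring, hq, hE',
      hu']
    field_simp
    ring
  have h2 : (s * (dT * B)) ^ 2 = (s * (Ξ ^ 2 * (a * E))) ^ 2 := by rw [hB]
  rw [show ∀ y z : ℝ, S * (y - dT * (1 / 2 * z)) = S * y - dT / 2 * (S * z) from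
    fun y z => by ring, h1]
  linear_combination (norm := (field_simp; ring)) (-(a * c * E) + c * dT * B / Ξ ^ 2) * hB -
    l * s * c / (dT * Ξ ^ 2) * h2
namespace IsTimelikeGeodesicOn

lemma hasDerivAt_coord (hI : IsOpen I) (hX : p.IsTimelikeGeodesicOn X I) {τ : ℝ} (hτ : τ ∈ I)
    (i : Fin 4) : HasDerivAt (fun s => X s i) (deriv X τ i) τ :=
  hasDerivAt_pi.1 (((hX.contDiffOn.contDiffAt (hI.mem_nhds hτ)).differentiableAt
    (by norm_num)).hasDerivAt) i

lemma energy_hasDerivAt (hX : p.IsTimelikeGeodesicOn X I) {τ : ℝ} (hτ : τ ∈ I) :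
    HasDerivAt (fun s => p.energy (X s) (deriv X s)) 0 τ := by
  refine (hX.geodesic τ hτ 0).congr_deriv ?_
  have h : (fun h => p.metric (Function.update (X τ) 0 h) (deriv X τ) (deriv X τ)) =
      fun _ => p.metric (X τ) (deriv X τ) (deriv X τ) := by
    funext h
    simp [metric]
  rw [h, deriv_const, mul_zero]

lemma angularMomentum_hasDerivAt (hX : p.IsTimelikeGeodesicOn X I) {τ : ℝ} (hτ : τ ∈ I) :
    HasDerivAt (fun s => p.angularMomentum (X s) (deriv X s)) 0 τ := by
  refine (hX.geodesic τ hτ 3).neg.congr_deriv ?_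
  have h : (fun h => p.metric (Function.update (X τ) 3 h) (deriv X τ) (deriv X τ)) =
      fun _ => p.metric (X τ) (deriv X τ) (deriv X τ) := by
    funext h
    simp [metric, Function.update_of_ne]
  rw [h, deriv_const, mul_zero, neg_zero]

lemma eq_of_hasDerivAt_zero {f : ℝ → ℝ} {a b : ℝ} (h : ∀ t ∈ Icc a b, HasDerivAt f 0 t) {t : ℝ}
    (ht : t ∈ Icc a b) : f t = f a :=
  constant_of_has_deriv_right_zero (fun s hs => (h s hs).continuousAt.continuousWithinAt)
    (fun s hs => (h s (Ico_subset_Icc_self hs)).hasDerivWithinAt) t ht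

/-- The `θ` component of the geodesic equation on polar orbits. -/
lemma polarMomentum_hasDerivAt (hΛ : 0 < p.Λ) (hI : IsOpen I) (hX : p.IsTimelikeGeodesicOn X I)
    {τ E : ℝ} (hτ : τ ∈ I) (hE : p.energy (X τ) (deriv X τ) = E)
    (hL : p.angularMomentum (X τ) (deriv X τ) = 0) :
    HasDerivAt (p.polarMomentum X) (Real.sin (X τ 2) * Real.cos (X τ 2) *
      (p.a ^ 2 * p.deltaTheta (X τ 2) - p.a ^ 2 * p.Λ / 3 * ((p.polarMomentum X τ ^ 2 +
        p.Xi ^ 2 * p.a ^ 2 * E ^ 2 * Real.sin (X τ 2) ^ 2) / p.deltaTheta (X τ 2)) -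
        p.Xi ^ 2 * p.a ^ 2 * E ^ 2) / p.rhoSq (X τ 1) (X τ 2)) τ := by
  have hXi := p.Xi_pos hΛ
  have hT := fun s => p.deltaTheta_pos hΛ (X s 2)
  have hS := hX.rhoSq_pos τ hτ
  have hθ := hX.hasDerivAt_coord hI hτ 2
  -- ρ² dθ/dτ is -Δ_θ times the covariant momentum, whose derivative the geodesic equation supplies.
  have hfun : p.polarMomentum X = fun s =>
      -p.deltaTheta (X s 2) * p.metric (X s) (deriv X s) (Pi.single 2 1) := by
    funext s
    have := hT s
    rw [metric_single_two, polarMomentum]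
    field_simp
  have hdT : HasDerivAt (fun s => -p.deltaTheta (X s 2))
      (2 * (p.a ^ 2 * p.Λ / 3) * Real.sin (X τ 2) * Real.cos (X τ 2) * deriv X τ 2) τ := by
    refine (((hθ.cos.pow 2).const_mul (p.a ^ 2 * p.Λ / 3)).const_add 1).neg.congr_deriv ?_
    simp
    ring
  have hgeo := hX.geodesic τ hτ 2
  rw [(metric_update_two_hasDerivAt hΛ hS).deriv] at hgeo
  have hmul := hdT.mul hgeo
  rw [metric_single_two] at hmul
  have hB := (deltaR_mul_of_polar hXi hS hE hL).2
  have hg := hX.properTime τ hτ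
  rw [metric] at hg
  rw [energy_eq] at hE
  have hu : deriv X τ 3 * p.rhoSq (X τ 1) (X τ 2) =
      p.a * (deriv X τ 0 - p.a * Real.sin (X τ 2) ^ 2 * deriv X τ 3) -
        (p.a * deriv X τ 0 - (X τ 1 ^ 2 + p.a ^ 2) * deriv X τ 3) := by
    rw [rhoSq, Real.cos_sq']
    ring
  have hE' : p.deltaR (X τ 1) * (deriv X τ 0 - p.a * Real.sin (X τ 2) ^ 2 * deriv X τ 3) -
      p.deltaTheta (X τ 2) * Real.sin (X τ 2) ^ 2 *
        (p.a * deriv X τ 0 - (X τ 1 ^ 2 + p.a ^ 2) * deriv X τ 3) * p.a =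
      p.Xi ^ 2 * p.rhoSq (X τ 1) (X τ 2) * E := by
    rw [← hE]
    field_simp
  have key := polar_force_algebra (l := p.a ^ 2 * p.Λ / 3) (c := Real.cos (X τ 2))
    (hT τ).ne' hXi.ne' hS.ne' hg hu hE' hB
  have hPdef : p.polarMomentum X τ = p.rhoSq (X τ 1) (X τ 2) * deriv X τ 2 := rfl
  rw [hPdef, hfun, ← key]
  refine hmul.congr_deriv ?_
  rw [mul_div_cancel_left₀ _ hS.ne']
  ring

/-- Carter's constant is conserved along polar orbits. -/
lemma killingTensor_eq (hΛ : 0 < p.Λ) (hI : IsOpen I) (hX : p.IsTimelikeGeodesicOn X I)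
    {τ₀ τ₁ E : ℝ} (hsub : Icc τ₀ τ₁ ⊆ I)
    (hE : ∀ τ ∈ Icc τ₀ τ₁, p.energy (X τ) (deriv X τ) = E)
    (hL : ∀ τ ∈ Icc τ₀ τ₁, p.angularMomentum (X τ) (deriv X τ) = 0) {τ : ℝ}
    (hτ : τ ∈ Icc τ₀ τ₁) :
    p.killingTensor (X τ) (deriv X τ) = p.killingTensor (X τ₀) (deriv X τ₀) := by
  -- In this reduced form only θ and `polarMomentum` vary, and the θ equation alone makes the
  -- derivative vanish.
  have hK : ∀ t ∈ Icc τ₀ τ₁, p.killingTensor (X t) (deriv X t) =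
      (p.polarMomentum X t ^ 2 + p.Xi ^ 2 * p.a ^ 2 * E ^ 2 * Real.sin (X t 2) ^ 2) /
        p.deltaTheta (X t 2) + p.a ^ 2 * Real.cos (X t 2) ^ 2 := fun t ht =>
    killingTensor_mul_deltaTheta hΛ (hX.rhoSq_pos t (hsub ht)) (hE t ht) (hL t ht)
      (hX.properTime t (hsub ht))
  rw [hK τ hτ, hK τ₀ (left_mem_Icc.2 (hτ.1.trans hτ.2))]
  refine eq_of_hasDerivAt_zero (f := fun t => (p.polarMomentum X t ^ 2 +
    p.Xi ^ 2 * p.a ^ 2 * E ^ 2 * Real.sin (X t 2) ^ 2) /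
        p.deltaTheta (X t 2) + p.a ^ 2 * Real.cos (X t 2) ^ 2) (fun t ht => ?_) hτ
  have hT := p.deltaTheta_pos hΛ (X t 2)
  have hS := hX.rhoSq_pos t (hsub ht)
  have hP := polarMomentum_hasDerivAt hΛ hI hX (hsub ht) (hE t ht) (hL t ht)
  have hθ := hX.hasDerivAt_coord hI (hsub ht) 2
  have hdT : HasDerivAt (fun s => p.deltaTheta (X s 2))
      (-(2 * (p.a ^ 2 * p.Λ / 3) * Real.sin (X t 2) * Real.cos (X t 2) * deriv X t 2)) t := by
    refine (((hθ.cos.pow 2).const_mul (p.a ^ 2 * p.Λ / 3)).const_add 1).congr_deriv ?_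
    simp
    ring
  have hu : deriv X t 2 = p.polarMomentum X t / p.rhoSq (X t 1) (X t 2) := by
    rw [polarMomentum]
    field_simp
  refine ((((hP.pow 2).add ((hθ.sin.pow 2).const_mul (p.Xi ^ 2 * p.a ^ 2 * E ^ 2))).div hdT
    hT.ne').add ((hθ.cos.pow 2).const_mul (p.a ^ 2))).congr_deriv ?_
  rw [hu]
  simp only [Pi.pow_apply, Pi.add_apply, Nat.cast_ofNat, Nat.reduceSub, pow_one]
  field_simp
  ring

end IsTimelikeGeodesicOn

end KNdS

/-! ### Motion of cos θ in Mino time -/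

namespace KNdS

variable {p : KNdS} {X : ℝ → Fin 4 → ℝ} {I : Set ℝ}

/-- The momentum conjugate to `cos θ` in Mino time, `ρ² d(cos θ)/dτ`. -/
def cosMomentum (p : KNdS) (X : ℝ → Fin 4 → ℝ) (τ : ℝ) : ℝ :=
  -Real.sin (X τ 2) * p.polarMomentum X τ

lemma angularCubic_hasDerivAt (E Q z : ℝ) :
    HasDerivAt (p.angularCubic E 0 Q)
      (-p.a ^ 2 * (1 + p.a ^ 2 * p.Λ / 3 * z) * (1 - z) +
        (Q + p.Xi ^ 2 * p.a ^ 2 * E ^ 2 - p.a ^ 2 * z) * (p.a ^ 2 * p.Λ / 3) * (1 - z) -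
        (Q + p.Xi ^ 2 * p.a ^ 2 * E ^ 2 - p.a ^ 2 * z) * (1 + p.a ^ 2 * p.Λ / 3 * z) +
        2 * p.Xi ^ 2 * p.a ^ 2 * E ^ 2 * (1 - z)) z := by
  have hid := hasDerivAt_id z
  have h1 := (hid.const_mul (p.a ^ 2)).const_sub (Q + p.Xi ^ 2 * (0 - p.a * E) ^ 2)
  have h2 := (hid.const_mul (p.a ^ 2 * p.Λ / 3)).const_add 1
  have h3 := hid.const_sub 1
  have h4 := (((h3.const_mul (p.a * E)).sub_const 0).pow 2).const_mul (p.Xi ^ 2)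
  refine (((h1.mul h2).mul h3).sub h4).congr_deriv ?_
  simp
  ring

namespace IsTimelikeGeodesicOn

variable {τ E Q : ℝ}

lemma polarMomentum_sq (hΛ : 0 < p.Λ) (hX : p.IsTimelikeGeodesicOn X I) (hτ : τ ∈ I)
    (hE : p.energy (X τ) (deriv X τ) = E) (hL : p.angularMomentum (X τ) (deriv X τ) = 0)
    (hK : p.killingTensor (X τ) (deriv X τ) = Q + p.Xi ^ 2 * p.a ^ 2 * E ^ 2) :
    (p.polarMomentum X τ ^ 2 + p.Xi ^ 2 * p.a ^ 2 * E ^ 2 * Real.sin (X τ 2) ^ 2) /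
      p.deltaTheta (X τ 2) =
        Q + p.Xi ^ 2 * p.a ^ 2 * E ^ 2 - p.a ^ 2 * Real.cos (X τ 2) ^ 2 := by
  rw [killingTensor_mul_deltaTheta hΛ (hX.rhoSq_pos τ hτ) hE hL (hX.properTime τ hτ)] at hK
  rw [← hK, polarMomentum]
  ring

lemma cosMomentum_sq (hΛ : 0 < p.Λ) (hX : p.IsTimelikeGeodesicOn X I) (hτ : τ ∈ I)
    (hE : p.energy (X τ) (deriv X τ) = E) (hL : p.angularMomentum (X τ) (deriv X τ) = 0)
    (hK : p.killingTensor (X τ) (deriv X τ) = Q + p.Xi ^ 2 * p.a ^ 2 * E ^ 2) :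
    p.cosMomentum X τ ^ 2 = p.angularCubic E 0 Q (Real.cos (X τ 2) ^ 2) := by
  have h := polarMomentum_sq hΛ hX hτ hE hL hK
  rw [div_eq_iff (p.deltaTheta_pos hΛ _).ne', deltaTheta] at h
  rw [cosMomentum, angularCubic, mul_pow, neg_sq, ← Real.sin_sq]
  linear_combination Real.sin (X τ 2) ^ 2 * h

lemma cos_hasDerivAt (hI : IsOpen I) (hX : p.IsTimelikeGeodesicOn X I) (hτ : τ ∈ I) :
    HasDerivAt (fun s => Real.cos (X s 2)) (p.cosMomentum X τ / p.rhoSq (X τ 1) (X τ 2)) τ := by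
  have hS := hX.rhoSq_pos τ hτ
  refine (hX.hasDerivAt_coord hI hτ 2).cos.congr_deriv ?_
  rw [cosMomentum, polarMomentum]
  field_simp

/-- Derived from the geodesic equation itself, not by differentiating `cosMomentum_sq`, which would
require division by a momentum that vanishes at turning points. -/
lemma cosMomentum_hasDerivAt (hΛ : 0 < p.Λ) (hI : IsOpen I) (hX : p.IsTimelikeGeodesicOn X I)
    (hτ : τ ∈ I) (hE : p.energy (X τ) (deriv X τ) = E)
    (hL : p.angularMomentum (X τ) (deriv X τ) = 0)
    (hK : p.killingTensor (X τ) (deriv X τ) = Q + p.Xi ^ 2 * p.a ^ 2 * E ^ 2) :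
    HasDerivAt (p.cosMomentum X) (Real.cos (X τ 2) *
      deriv (p.angularCubic E 0 Q) (Real.cos (X τ 2) ^ 2) / p.rhoSq (X τ 1) (X τ 2)) τ := by
  have hS := hX.rhoSq_pos τ hτ
  have h := polarMomentum_sq hΛ hX hτ hE hL hK
  have hP := polarMomentum_hasDerivAt hΛ hI hX hτ hE hL
  rw [h] at hP
  rw [div_eq_iff (p.deltaTheta_pos hΛ _).ne'] at h
  refine ((hX.hasDerivAt_coord hI hτ 2).sin.neg.mul hP).congr_deriv ?_
  rw [(angularCubic_hasDerivAt E Q _).deriv, ← Real.sin_sq]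
  have hu : deriv X τ 2 = p.polarMomentum X τ / p.rhoSq (X τ 1) (X τ 2) := by
    rw [polarMomentum]
    field_simp
  rw [hu]
  rw [deltaTheta] at h ⊢
  simp only [Pi.neg_apply]
  field_simp
  linear_combination -(3 * Real.cos (X τ 2)) * h

end IsTimelikeGeodesicOn

end KNdS

/-! ### Uniqueness, Mino time and the polar motion -/

/-- Uniqueness for `y' = q / S(t)`, `q' = f(y) / S(t)` within the strip `|y| ≤ 1`. -/
lemma eq_of_oscillator {S f y q y' q' : ℝ → ℝ} {a b : ℝ} (hab : a ≤ b) (hf : ContDiff ℝ 1 f)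
    (hS : ContinuousOn S (Icc a b)) (hS0 : ∀ t ∈ Icc a b, 0 < S t)
    (hy : ∀ t ∈ Icc a b, HasDerivAt y (q t / S t) t)
    (hq : ∀ t ∈ Icc a b, HasDerivAt q (f (y t) / S t) t)
    (hy' : ∀ t ∈ Icc a b, HasDerivAt y' (q' t / S t) t)
    (hq' : ∀ t ∈ Icc a b, HasDerivAt q' (f (y' t) / S t) t)
    (hb : ∀ t ∈ Icc a b, |y t| ≤ 1) (hb' : ∀ t ∈ Icc a b, |y' t| ≤ 1)
    (h0 : y a = y' a) (h0' : q a = q' a) : y b = y' b := by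
  -- The force is only C¹, so its Lipschitz constant exists on the compact strip; this is why both
  -- solutions must stay in |y| ≤ 1.
  obtain ⟨K, hK⟩ := (hf.contDiffOn (s := Icc (-1 : ℝ) 1)).exists_lipschitzOnWith one_ne_zero
    (convex_Icc _ _) isCompact_Icc
  have hSi : ContinuousOn (fun t => 1 / S t) (Icc a b) :=
    continuousOn_const.div hS fun t ht => (hS0 t ht).ne'
  obtain ⟨M, hM⟩ := isCompact_Icc.bddAbove_image hSi
  have hM' : ∀ t ∈ Icc a b, 1 / S t ≤ M := fun t ht => hM (mem_image_of_mem _ ht)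
  have hM0 : 0 ≤ M := (one_div_pos.2 (hS0 a (left_mem_Icc.2 hab))).le.trans
    (hM' a (left_mem_Icc.2 hab))
  set v : ℝ → ℝ × ℝ → ℝ × ℝ := fun t w => (w.2 / S t, f w.1 / S t) with hv
  have hlip : ∀ t ∈ Ico a b, LipschitzOnWith (M.toNNReal * max 1 K) (v t) {w | |w.1| ≤ 1} := by
    intro t ht
    have hSt := hS0 t (Ico_subset_Icc_self ht)
    have hMt := hM' t (Ico_subset_Icc_self ht)
    refine LipschitzOnWith.of_dist_le_mul fun w hw w' hw' => ?_
    have h1 : dist w.1 w'.1 ≤ dist w w' := le_max_left _ _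
    have h2 : dist w.2 w'.2 ≤ dist w w' := le_max_right _ _
    have h3 := hK.dist_le_mul w.1 (abs_le.1 hw) w'.1 (abs_le.1 hw')
    have hdiv : ∀ x x' : ℝ, dist (x / S t) (x' / S t) = 1 / S t * dist x x' := fun x x' => by
      rw [Real.dist_eq, Real.dist_eq, ← sub_div, abs_div, abs_of_pos hSt]
      ring
    have hmain : ∀ x x' : ℝ, dist x x' ≤ (max 1 K : NNReal) * dist w w' →
        dist (x / S t) (x' / S t) ≤ (M.toNNReal * max 1 K : NNReal) * dist w w' := fun x x' h => by
      rw [hdiv, NNReal.coe_mul, Real.coe_toNNReal _ hM0, mul_assoc]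
      exact mul_le_mul hMt h dist_nonneg hM0
    rw [Prod.dist_eq]
    refine max_le (hmain _ _ ?_) (hmain _ _ ?_)
    · refine h2.trans (le_mul_of_one_le_left dist_nonneg ?_)
      exact_mod_cast le_max_left _ _
    · refine h3.trans (mul_le_mul ?_ h1 dist_nonneg (NNReal.coe_nonneg _))
      exact_mod_cast le_max_right _ _
  have hd : ∀ t ∈ Icc a b, HasDerivAt (fun t => (y t, q t)) (v t (y t, q t)) t := fun t ht =>
    (hy t ht).prodMk (hq t ht)
  have hd' : ∀ t ∈ Icc a b, HasDerivAt (fun t => (y' t, q' t)) (v t (y' t, q' t)) t :=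
    fun t ht => (hy' t ht).prodMk (hq' t ht)
  have h := ODE_solution_unique_of_mem_Icc_right hlip
    (fun t ht => (hd t ht).continuousAt.continuousWithinAt)
    (fun t ht => (hd t (Ico_subset_Icc_self ht)).hasDerivWithinAt)
    (fun t ht => hb t (Ico_subset_Icc_self ht))
    (fun t ht => (hd' t ht).continuousAt.continuousWithinAt)
    (fun t ht => (hd' t (Ico_subset_Icc_self ht)).hasDerivWithinAt)
    (fun t ht => hb' t (Ico_subset_Icc_self ht)) (Prod.ext h0 h0') (right_mem_Icc.2 hab)
  exact congrArg Prod.fst h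

/-- The Mino time `∫ dτ / S` elapsed while `r`, with `(S dr/dτ)² = R(r)`, moves monotonically. -/
lemma integral_one_div_eq_of_radial {S r r' R G : ℝ → ℝ} {a b rP rA ε : ℝ} (hab : a ≤ b)
    (hS : ContinuousOn S (Icc a b)) (hS0 : ∀ t ∈ Icc a b, 0 < S t) (hε : ε ^ 2 = 1)
    (hr : ∀ t ∈ Icc a b, HasDerivAt r (r' t) t) (hr' : ∀ t ∈ Ioo a b, 0 ≤ ε * r' t)
    (hm : ∀ t ∈ Icc a b, r t ∈ Icc rP rA) (hm' : ∀ t ∈ Ioo a b, r t ∈ Ioo rP rA)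
    (hrR : ∀ t ∈ Icc a b, (S t * r' t) ^ 2 = R (r t)) (hR : ∀ x ∈ Ioo rP rA, 0 < R x)
    (hGc : ContinuousOn G (Icc rP rA)) (hG : ∀ x ∈ Ioo rP rA, HasDerivAt G (1 / √(R x)) x) :
    ∫ t in a..b, 1 / S t = ε * (G (r b) - G (r a)) := by
  have hi : IntervalIntegrable (fun t => 1 / S t) volume a b := by
    refine ContinuousOn.intervalIntegrable ?_
    rw [uIcc_of_le hab]
    exact continuousOn_const.div hS fun t ht => (hS0 t ht).ne'
  -- `ε * G ∘ r` is an antiderivative of 1/S. Its derivative is needed only in the open interval,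
  -- since 1/√R may blow up at the turning points, where continuity of G suffices.
  rw [intervalIntegral.integral_eq_sub_of_hasDerivAt_of_le (f := fun t => ε * G (r t)) hab ?_ ?_ hi]
  · ring
  · exact continuousOn_const.mul (hGc.comp
      (fun t ht => (hr t ht).continuousAt.continuousWithinAt) hm)
  · intro t ht
    have ht' := Ioo_subset_Icc_self ht
    refine (((hG _ (hm' t ht)).comp t (hr t ht')).const_mul ε).congr_deriv ?_
    have hSt := hS0 t ht'
    have h1 : √(R (r t)) = S t * (ε * r' t) := by
      rw [← hrR t ht', Real.sqrt_eq_iff_mul_self_eq (sq_nonneg _)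
        (mul_nonneg hSt.le (hr' t ht))]
      linear_combination -(S t * r' t) ^ 2 * hε
    have h2 := Real.sqrt_pos.2 (hR _ (hm' t ht))
    rw [h1] at h2 ⊢
    have h3 : 0 < ε * r' t := pos_of_mul_pos_right h2 hSt.le
    have h4 : r' t ≠ 0 := fun h => by simp [h] at h3
    have h5 : ε ≠ 0 := fun h => by simp [h] at h3
    field_simp

/-- The Mino time of one complete radial oscillation. -/
lemma integral_one_div_of_radialOscillation {S r r' R G : ℝ → ℝ} {a b rP rA : ℝ}
    (hosc : IsRadialOscillation r a b rP rA)
    (hS : ContinuousOn S (Icc a b)) (hS0 : ∀ t ∈ Icc a b, 0 < S t)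
    (hr : ∀ t ∈ Icc a b, HasDerivAt r (r' t) t)
    (hrR : ∀ t ∈ Icc a b, (S t * r' t) ^ 2 = R (r t)) (hR : ∀ x ∈ Ioo rP rA, 0 < R x)
    (hGc : ContinuousOn G (Icc rP rA)) (hG : ∀ x ∈ Ioo rP rA, HasDerivAt G (1 / √(R x)) x) :
    ∫ t in a..b, 1 / S t = 2 * (G rA - G rP) := by
  obtain ⟨c, hc, ha, hcA, hb, hmono, hanti⟩ := hosc
  have hl : Icc a c ⊆ Icc a b := Icc_subset_Icc_right hc.2.le
  have hr2 : Icc c b ⊆ Icc a b := Icc_subset_Icc_left hc.1.le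
  have hac := left_mem_Icc.2 hc.1.le
  have hca := right_mem_Icc.2 hc.1.le
  have hcb := left_mem_Icc.2 hc.2.le
  have hbc := right_mem_Icc.2 hc.2.le
  have h1 := integral_one_div_eq_of_radial (ε := 1) hc.1.le (hS.mono hl)
    (fun t ht => hS0 t (hl ht)) (by norm_num) (fun t ht => hr t (hl ht)) (fun t ht => by
      have h := hmono.monotoneOn.derivWithin_nonneg (x := t)
      rwa [((hr t (hl (Ioo_subset_Icc_self ht))).hasDerivWithinAt).derivWithin
        (uniqueDiffOn_Icc hc.1 t (Ioo_subset_Icc_self ht)), ← one_mul (r' t)] at h)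
    (fun t ht => ⟨ha ▸ hmono.monotoneOn hac ht ht.1, hcA ▸ hmono.monotoneOn ht hca ht.2⟩)
    (fun t ht => ⟨ha ▸ hmono hac (Ioo_subset_Icc_self ht) ht.1,
      hcA ▸ hmono (Ioo_subset_Icc_self ht) hca ht.2⟩) (fun t ht => hrR t (hl ht)) hR hGc hG
  have h2 := integral_one_div_eq_of_radial (ε := -1) hc.2.le (hS.mono hr2)
    (fun t ht => hS0 t (hr2 ht)) (by norm_num) (fun t ht => hr t (hr2 ht)) (fun t ht => by
      have h := hanti.antitoneOn.derivWithin_nonpos (x := t)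
      rw [((hr t (hr2 (Ioo_subset_Icc_self ht))).hasDerivWithinAt).derivWithin
        (uniqueDiffOn_Icc hc.2 t (Ioo_subset_Icc_self ht))] at h
      linarith)
    (fun t ht => ⟨hb ▸ hanti.antitoneOn ht hbc ht.2, hcA ▸ hanti.antitoneOn hcb ht ht.1⟩)
    (fun t ht => ⟨hb ▸ hanti (Ioo_subset_Icc_self ht) hbc ht.2,
      hcA ▸ hanti hcb (Ioo_subset_Icc_self ht) ht.1⟩) (fun t ht => hrR t (hr2 ht)) hR hGc hG
  have hi : ∀ u v, Icc u v ⊆ Icc a b → u ≤ v →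
      IntervalIntegrable (fun t => 1 / S t) volume u v := fun u v huv h => by
    refine ContinuousOn.intervalIntegrable ?_
    rw [uIcc_of_le h]
    exact continuousOn_const.div (hS.mono huv) fun t ht => (hS0 t (huv ht)).ne'
  rw [← intervalIntegral.integral_add_adjacent_intervals (hi a c hl hc.1.le) (hi c b hr2 hc.2.le),
    h1, h2, ha, hb, hcA]
  ring

lemma polarCos_sq (n m A c l : ℝ) (hn : n < 1) : polarCos n m A c l ^ 2 =
    A ^ 2 * Real.cos (jacobiAm m (c * l)) ^ 2 / (1 - n * Real.sin (jacobiAm m (c * l)) ^ 2) := by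
  rw [polarCos, div_pow, mul_pow, Real.sq_sqrt (one_sub_mul_sin_sq_pos hn _).le]

/-- Since n < 1, cos²φ ≤ 1 - n sin²φ. This keeps the explicit solution in the strip required by
`eq_of_oscillator`. -/
lemma abs_polarCos_le_one {n A : ℝ} (m c l : ℝ) (hn : n < 1) (hA : A ^ 2 ≤ 1) :
    |polarCos n m A c l| ≤ 1 := by
  rw [← sq_le_one_iff_abs_le_one, polarCos_sq n m A c l hn,
    div_le_one (one_sub_mul_sin_sq_pos hn _)]
  have h1 := Real.sin_sq_add_cos_sq (jacobiAm m (c * l))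
  nlinarith [sq_nonneg (Real.sin (jacobiAm m (c * l))), sq_nonneg (Real.cos (jacobiAm m (c * l)))]

/-- Along a polar orbit that starts at an extremal latitude, `cos² θ` is an elliptic function of
Mino time. -/
lemma KNdS.IsTimelikeGeodesicOn.cos_sq_eq {p : KNdS} {X : ℝ → Fin 4 → ℝ} {I : Set ℝ}
    (hΛ : 0 < p.Λ) (ha : p.a ≠ 0) (hI : IsOpen I) (hX : p.IsTimelikeGeodesicOn X I)
    {τ₀ τ₁ E Q : ℝ} (hτ : τ₀ ≤ τ₁) (hsub : Icc τ₀ τ₁ ⊆ I)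
    (hE : ∀ τ ∈ Icc τ₀ τ₁, p.energy (X τ) (deriv X τ) = E)
    (hL : ∀ τ ∈ Icc τ₀ τ₁, p.angularMomentum (X τ) (deriv X τ) = 0)
    (hK : ∀ τ ∈ Icc τ₀ τ₁,
      p.killingTensor (X τ) (deriv X τ) = Q + p.Xi ^ 2 * p.a ^ 2 * E ^ 2)
    {zΛ zm zp : ℝ} (hzΛ : zΛ < 0) (hzm : 0 < zm) (hzp : zm < zp)
    (hz : ∀ z, p.angularCubic E 0 Q z = p.a ^ 4 * p.Λ / 3 * ((z - zΛ) * (z - zp) * (z - zm)))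
    (hlat : Real.cos (X τ₀ 2) ^ 2 = zm) {n m c : ℝ} (hn : n = zm / zp)
    (hm : m = zm * (zp - zΛ) / (zp * (zm - zΛ)))
    (hc : c ^ 2 = p.a ^ 4 * p.Λ / 3 * (zm - zΛ) * zp) (hn1 : n < 1) (hm1 : m < 1) :
    Real.cos (X τ₁ 2) ^ 2 = zm *
      Real.cos (jacobiAm m (c * ∫ s in τ₀..τ₁, 1 / p.rhoSq (X s 1) (X s 2))) ^ 2 /
      (1 - n * Real.sin (jacobiAm m (c * ∫ s in τ₀..τ₁, 1 / p.rhoSq (X s 1) (X s 2))) ^ 2) := by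
  have hC : 0 < p.a ^ 4 * p.Λ / 3 := by positivity
  set C := p.a ^ 4 * p.Λ / 3 with hCdef
  set S : ℝ → ℝ := fun s => p.rhoSq (X s 1) (X s 2) with hSdef
  have hSpos : ∀ s ∈ I, 0 < S s := fun s hs => hX.rhoSq_pos s hs
  have hSc : ContinuousOn S I := fun s hs => by
    have h1 := (hX.hasDerivAt_coord hI hs 1).continuousAt
    have h2 := (hX.hasDerivAt_coord hI hs 2).continuousAt
    exact ((h1.pow 2).add (continuousAt_const.mul
      ((Real.continuous_cos.continuousAt.comp h2).pow 2))).continuousWithinAt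
  have hSi : ContinuousOn (fun s => 1 / S s) I :=
    continuousOn_const.div hSc fun s hs => (hSpos s hs).ne'
  set lam : ℝ → ℝ := fun t => ∫ s in τ₀..t, 1 / S s with hlam
  have hlam' : ∀ t ∈ Icc τ₀ τ₁, HasDerivAt lam (1 / S t) t := fun t ht => by
    refine intervalIntegral.integral_hasDerivAt_right ?_
      (hSi.stronglyMeasurableAtFilter hI t (hsub ht)) (hSi.continuousAt (hI.mem_nhds (hsub ht)))
    refine ContinuousOn.intervalIntegrable ?_
    rw [uIcc_of_le ht.1]
    exact hSi.mono ((Icc_subset_Icc_right ht.2).trans hsub)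
  have h0 : τ₀ ∈ Icc τ₀ τ₁ := left_mem_Icc.2 hτ
  -- The signed value is kept as amplitude, so both hemispheres are treated at once.
  set A := Real.cos (X τ₀ 2) with hA
  have hA1 : A ^ 2 ≤ 1 := Real.cos_sq_le_one _
  set f : ℝ → ℝ := fun y => y * (C * ((y ^ 2 - zp) * (y ^ 2 - zm) + (y ^ 2 - zΛ) * (y ^ 2 - zm) +
    (y ^ 2 - zΛ) * (y ^ 2 - zp))) with hf
  have hder : ∀ z, deriv (p.angularCubic E 0 Q) z = C * ((z - zp) * (z - zm) +
      (z - zΛ) * (z - zm) + (z - zΛ) * (z - zp)) := fun z => by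
    rw [show p.angularCubic E 0 Q = fun z => C * ((z - zΛ) * (z - zp) * (z - zm)) from funext hz]
    have hid := hasDerivAt_id z
    refine HasDerivAt.deriv ((((((hid.sub_const zΛ).mul (hid.sub_const zp)).mul
      (hid.sub_const zm)).const_mul C)).congr_deriv ?_)
    simp
    left
    ring
  have hfinal : Real.cos (X τ₁ 2) = polarCos n m A c (lam τ₁) := by
    refine eq_of_oscillator (S := S) (f := f) (y := fun s => Real.cos (X s 2))
      (q := p.cosMomentum X) (y' := fun s => polarCos n m A c (lam s))
      (q' := fun s => polarCosDeriv n m A c (lam s)) hτ (by fun_prop) (hSc.mono hsub)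
      (fun t ht => hSpos t (hsub ht)) (fun t ht => hX.cos_hasDerivAt hI (hsub ht))
      (fun t ht => ?_) (fun t ht => ?_) (fun t ht => ?_) (fun t _ => Real.abs_cos_le_one _)
      (fun t _ => abs_polarCos_le_one _ _ _ hn1 hA1) ?_ ?_
    · have h := hX.cosMomentum_hasDerivAt hΛ hI (hsub ht) (hE t ht) (hL t ht) (hK t ht)
      rwa [hder] at h
    · refine ((polarCos_hasDerivAt hn1 hm1 A c (lam t)).comp t (hlam' t ht)).congr_deriv ?_
      ring
    · refine ((polarCosDeriv_hasDerivAt hC hzΛ hzm hzp hn hm hlat hc hn1 hm1 (lam t)).comp t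
        (hlam' t ht)).congr_deriv ?_
      simp only [hf]
      ring
    · simp [hlam, polarCos, jacobiAm_zero hm1, hA]
    -- An extremal latitude is a root of the angular cubic, so the initial momentum vanishes, as
    -- does `polarCosDeriv` at amplitude 0.
    · have h := hX.cosMomentum_sq hΛ (hsub h0) (hE _ h0) (hL _ h0) (hK _ h0)
      rw [hlat, hz, sub_self, mul_zero, mul_zero] at h
      rw [pow_eq_zero_iff two_ne_zero] at h
      simp [h, hlam, polarCosDeriv, jacobiAm_zero hm1]
  rw [hfinal, polarCos_sq _ _ _ _ _ hn1, hlat]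

/-! ### Imaginary argument and the final formula -/

lemma ofReal_cpow_half_of_neg {x : ℝ} (hx : x < 0) :
    (x : ℂ) ^ (1 / 2 : ℂ) = Complex.I * (√(-x) : ℝ) := by
  rw [Complex.ofReal_cpow_of_nonpos hx.le, Real.sqrt_eq_rpow, Complex.ofReal_cpow (by linarith)]
  have h : Complex.exp (Real.pi * Complex.I * (1 / 2 : ℂ)) = Complex.I := by
    rw [show (Real.pi * Complex.I * (1 / 2 : ℂ)) = Real.pi / 2 * Complex.I by ring,
      Complex.exp_pi_div_two_mul_I]
  rw [h]
  push_cast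
  ring

theorem mainTheorem9 (p : KNdS) (hΛ : 0 < p.Λ) (ha : p.a ≠ 0)
    -- a polar timelike geodesic with constants of motion `E`, `L = 0`, `Q`
    (X : ℝ → Fin 4 → ℝ) (I : Set ℝ) (hI : IsOpen I) (hX : p.IsTimelikeGeodesicOn X I)
    (τ₀ τ₁ : ℝ) (hsub : Set.Icc τ₀ τ₁ ⊆ I) (E Q : ℝ)
    (hE : p.energy (X τ₀) (deriv X τ₀) = E)
    (hL : p.angularMomentum (X τ₀) (deriv X τ₀) = 0)
    (hQ : p.carterConstant (X τ₀) (deriv X τ₀) = Q)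
    -- the real roots of the sextic radial polynomial
    (rΛ₁ rA rP r₃ r₄ rΛ₂ : ℝ) (hΛA : rA < rΛ₁) (hAP : rP < rA)
    (h₃ : r₃ < rP) (h₄ : r₄ < rP) (hΛ₂ : rΛ₂ < rP)
    (hR : ∀ r, p.radialR E 0 Q r =
      p.Λ / 3 * ((r - rΛ₁) * (r - rA) * (r - rP) * (r - r₃) * (r - r₄) * (r - rΛ₂)))
    -- the roots of the angular cubic
    (zΛ zm zp : ℝ) (hzΛ : zΛ < 0) (hzm : 0 < zm) (hzp : zm < zp)
    (hz : ∀ z, p.angularCubic E 0 Q z =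
      p.a ^ 4 * p.Λ / 3 * ((z - zΛ) * (z - zp) * (z - zm)))
    -- one complete radial oscillation, starting at an extremal latitude
    (hosc : IsRadialOscillation (fun τ => X τ 1) τ₀ τ₁ rP rA)
    (hlat : Real.cos (X τ₀ 2) ^ 2 = zm) :
    let ω : ℝ := (rA - rP) / (rΛ₁ - rP)
    let H : ℝ := √((rA - rP) * (rA - r₃) * (rA - r₄) * (rA - rΛ₂))
    let x : Fin 3 → ℝ := ![ω * ((rΛ₁ - r₃) / (rA - r₃)), ω * ((rΛ₁ - r₄) / (rA - r₄)),
      ω * ((rΛ₁ - rΛ₂) / (rA - rΛ₂))]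
    let b : Fin 3 → ℝ := ![1 / 2, 1 / 2, 1 / 2]
    let T : ℝ := 2 * (√ω / (√(p.Λ / 3) * H)) *
      (-lauricellaFD (1 / 2) b 1 x * Real.pi + ω * lauricellaFD (3 / 2) b 2 x * (Real.pi / 2))
    let ω₁ : ℝ := (zp - zm) / zp
    let k2 : ℝ := ω₁ * zΛ / (zΛ - zm)
    let w : ℂ := (T : ℂ) * (((zΛ - zm : ℝ) : ℂ) ^ (1 / 2 : ℂ) *
      ((√(zp - zm) * p.a ^ 2 / √ω₁ * √(p.Λ / 3) : ℝ) : ℂ))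
    -- the two Lauricella series converge absolutely, and `T` is the radial period
    Summable (lauricellaTerm (1 / 2) b 1 x) ∧ Summable (lauricellaTerm (3 / 2) b 2 x) ∧
    IntervalIntegrable (fun r => 1 / √(p.radialR E 0 Q r)) MeasureTheory.volume rA rP ∧
    2 * (∫ r in rA..rP, 1 / √(p.radialR E 0 Q r)) = T ∧
    -- the polar angle after the oscillation (with `z = 0` where `sn` is infinite)
    ∃ z : ℝ, 0 ≤ z ∧ z ≤ 1 ∧
      (¬ IsJacobiSnPole k2 w → (ω₁ : ℂ) * jacobiSn k2 w ^ 2 - 1 ≠ 0 ∧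
        (z : ℂ) = -(zm : ℂ) / ((ω₁ : ℂ) * jacobiSn k2 w ^ 2 - 1)) ∧
      (IsJacobiSnPole k2 w → z = 0) ∧
      (Real.arccos (Real.cos (X τ₁ 2)) = Real.arccos √z ∨
        Real.arccos (Real.cos (X τ₁ 2)) = Real.arccos (-√z)) := by
  intro ω H x b T ω₁ k2 w
  obtain ⟨τm, hτm, -⟩ := id hosc
  have hτ : τ₀ ≤ τ₁ := (hτm.1.trans hτm.2).le
  have h0 : τ₀ ∈ Icc τ₀ τ₁ := left_mem_Icc.2 hτ
  have h1 : τ₁ ∈ Icc τ₀ τ₁ := right_mem_Icc.2 hτ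
  -- constants of motion
  have hEc : ∀ τ ∈ Icc τ₀ τ₁, p.energy (X τ) (deriv X τ) = E := fun τ ht => by
    rw [← hE]
    exact KNdS.IsTimelikeGeodesicOn.eq_of_hasDerivAt_zero
      (fun t ht => hX.energy_hasDerivAt (hsub ht)) ht
  have hLc : ∀ τ ∈ Icc τ₀ τ₁, p.angularMomentum (X τ) (deriv X τ) = 0 := fun τ ht => by
    rw [← hL]
    exact KNdS.IsTimelikeGeodesicOn.eq_of_hasDerivAt_zero
      (fun t ht => hX.angularMomentum_hasDerivAt (hsub ht)) ht
  have hKc : ∀ τ ∈ Icc τ₀ τ₁,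
      p.killingTensor (X τ) (deriv X τ) = Q + p.Xi ^ 2 * p.a ^ 2 * E ^ 2 := fun τ ht => by
    rw [hX.killingTensor_eq hΛ hI hsub hEc hLc ht, ← hQ, KNdS.carterConstant, hL, hE]
    ring
  -- the radial integral
  have hl : 0 < p.Λ / 3 := by positivity
  have hγ : ∀ i, (![r₃, r₄, rΛ₂] : Fin 3 → ℝ) i < rP := by
    intro i
    fin_cases i
    exacts [h₃, h₄, hΛ₂]
  obtain ⟨G, hGc, hG, hGd⟩ := exists_antideriv_one_div_sqrt_sextic hl hΛA hAP hγ
  have hx : x = fun i => ω * ((rΛ₁ - (![r₃, r₄, rΛ₂] : Fin 3 → ℝ) i) /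
      (rA - (![r₃, r₄, rΛ₂] : Fin 3 → ℝ) i)) := by
    funext i
    fin_cases i <;> rfl
  have hb : b = fun _ => 1 / 2 := by
    funext i
    fin_cases i <;> rfl
  have hx0 : ∀ i, 0 ≤ x i := fun i => by
    rw [hx]
    exact (crossRatio_mem hΛA hAP (hγ i)).1
  have hx1 : ∀ i, x i < 1 := fun i => by
    rw [hx]
    exact (crossRatio_mem hΛA hAP (hγ i)).2
  have hint := integral_one_sub_mul_prod_eq_lauricella ω x hx0 hx1
  -- T has the sign of the integral from rA down to rP, hence the minus.
  have hGT : G rA - G rP = -T / 2 := by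
    rw [hGd]
    simp only [hx] at hint
    rw [hint]
    simp only [T, hb, hx, H, ω]
    simp
    ring
  have hG' : ∀ r ∈ Ioo rP rA, HasDerivAt G (1 / √(p.radialR E 0 Q r)) r := fun r hr => by
    rw [hR]
    exact hG r hr
  have hRpos : ∀ r ∈ Ioo rP rA, 0 < p.radialR E 0 Q r := fun r hr => by
    rw [hR]
    have e1 : 0 < rΛ₁ - r := by linarith [hr.2]
    have e2 : 0 < rA - r := by linarith [hr.2]
    have e3 : 0 < r - rP := by linarith [hr.1]
    have e4 : 0 < r - r₃ := by linarith
    have e5 : 0 < r - r₄ := by linarith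
    have e6 : 0 < r - rΛ₂ := by linarith
    rw [show (r - rΛ₁) * (r - rA) = (rΛ₁ - r) * (rA - r) by ring]
    positivity
  have hii : IntervalIntegrable (fun r => 1 / √(p.radialR E 0 Q r)) volume rP rA := by
    -- The integrand is singular at both turning points; it is integrable as the nonnegative
    -- derivative of a function continuous up to them.
    refine intervalIntegral.intervalIntegrable_deriv_of_nonneg (g := G) ?_ ?_
      (fun r _ => by positivity)
    · rwa [uIcc_of_le hAP.le]
    · rwa [min_eq_left hAP.le, max_eq_right hAP.le]
  have hval := intervalIntegral.integral_eq_sub_of_hasDerivAt_of_le hAP.le hGc hG' hii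
  refine ⟨?_, ?_, hii.symm, ?_, ?_⟩
  · rw [hb]
    exact (hasSum_lauricellaTerm_half_one x hx0 hx1).summable
  · rw [hb]
    exact (hasSum_lauricellaTerm_three_half_two x hx0 hx1).summable
  · rw [intervalIntegral.integral_symm, hval, hGT]
    ring
  -- the polar angle
  have hlamT : ∫ s in τ₀..τ₁, 1 / p.rhoSq (X s 1) (X s 2) = -T := by
    rw [integral_one_div_of_radialOscillation (S := fun s => p.rhoSq (X s 1) (X s 2))
      (r' := fun s => deriv X s 1) (R := p.radialR E 0 Q) hosc ?_
      (fun t ht => hX.rhoSq_pos t (hsub ht)) (fun t ht => hX.hasDerivAt_coord hI (hsub ht) 1)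
      (fun t ht => KNdS.rhoSq_mul_radial_sq hΛ (hX.deltaR_pos t (hsub ht))
        (hX.rhoSq_pos t (hsub ht)) (hEc t ht) (hLc t ht) (hX.properTime t (hsub ht)) (hKc t ht))
      hRpos hGc hG', hGT]
    · ring
    · intro s hs
      have e1 := (hX.hasDerivAt_coord hI (hsub hs) 1).continuousAt
      have e2 := (hX.hasDerivAt_coord hI (hsub hs) 2).continuousAt
      exact ((e1.pow 2).add (continuousAt_const.mul
        ((Real.continuous_cos.continuousAt.comp e2).pow 2))).continuousWithinAt
  have hzp0 : 0 < zp := hzm.trans hzp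
  have hd : 0 < zm - zΛ := by linarith
  have hd' : 0 < zp - zm := by linarith
  have hω₁ : 0 < ω₁ := div_pos hd' hzp0
  have hω₁n : ω₁ = 1 - zm / zp := by
    simp only [ω₁]
    field_simp
  have hn1 : zm / zp < 1 := (div_lt_one hzp0).2 hzp
  have hk0 : 0 < k2 := div_pos_of_neg_of_neg (mul_neg_of_pos_of_neg hω₁ hzΛ) (by linarith)
  -- The parameter of the real solution is complementary to ϰ², which is what makes the argument of
  -- sn imaginary.
  have hkm : 1 - k2 = zm * (zp - zΛ) / (zp * (zm - zΛ)) := by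
    have : zΛ - zm ≠ 0 := by linarith
    simp only [k2, ω₁]
    field_simp
    ring
  have hk1 : k2 < 1 := by
    have : 0 < 1 - k2 := by
      rw [hkm]
      have : 0 < zp - zΛ := by linarith
      positivity
    linarith
  have hm1 : 1 - k2 < 1 := by linarith
  set c : ℝ := √(zm - zΛ) * (√(zp - zm) * p.a ^ 2 / √ω₁ * √(p.Λ / 3)) with hc
  have hc2 : c ^ 2 = p.a ^ 4 * p.Λ / 3 * (zm - zΛ) * zp := by
    rw [hc, mul_pow, mul_pow, div_pow, mul_pow, Real.sq_sqrt hd.le, Real.sq_sqrt hd'.le,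
      Real.sq_sqrt hω₁.le, Real.sq_sqrt hl.le]
    simp only [ω₁]
    field_simp
  have hw : w = Complex.I * ((c * T : ℝ) : ℂ) := by
    simp only [w]
    rw [ofReal_cpow_half_of_neg (by linarith : zΛ - zm < 0), hc, neg_sub]
    push_cast
    ring
  have hy := hX.cos_sq_eq hΛ ha hI hτ hsub hEc hLc hKc hzΛ hzm hzp hz hlat rfl hkm hc2 hn1 hm1
  -- The elapsed Mino time is -T, but the solution is even, so T may replace it.
  rw [hlamT, mul_neg, jacobiAm_neg hm1, Real.cos_neg, Real.sin_neg, neg_sq] at hy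
  set φ := jacobiAm (1 - k2) (c * T) with hφ
  have hD := one_sub_mul_sin_sq_pos hn1 φ
  refine ⟨Real.cos (X τ₁ 2) ^ 2, sq_nonneg _, Real.cos_sq_le_one _, ?_, ?_, ?_⟩
  · intro hpole
    rw [hw, isJacobiSnPole_I_mul_iff hk0] at hpole
    have hcos : Real.cos φ ^ 2 ≠ 0 := pow_ne_zero 2 hpole
    -- Here sn = i tan φ, so with ω₁ = 1 - n the denominator is -(1 - n sin²φ)/cos²φ, which never
    -- vanishes.
    have hden : (ω₁ : ℂ) * jacobiSn k2 w ^ 2 - 1 =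
        ((-(1 - zm / zp * Real.sin φ ^ 2) / Real.cos φ ^ 2 : ℝ) : ℂ) := by
      rw [hw, jacobiSn_I_mul hk1, mul_pow, Complex.I_sq]
      simp only [jacobiSnReal, jacobiCnReal, ← hφ]
      rw [hω₁n]
      have e : -(1 - zm / zp * Real.sin φ ^ 2) / Real.cos φ ^ 2 =
          (1 - zm / zp) * (-1 * (Real.sin φ / Real.cos φ) ^ 2) - 1 := by
        have hcos1 : Real.cos φ ≠ 0 := hpole
        field_simp
        linear_combination zp * Real.sin_sq_add_cos_sq φ
      rw [e]
      push_cast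
      ring
    rw [hden]
    refine ⟨?_, ?_⟩
    · exact_mod_cast div_ne_zero (neg_ne_zero.2 hD.ne') hcos
    · rw [hy]
      have e : zm * Real.cos φ ^ 2 / (1 - zm / zp * Real.sin φ ^ 2) =
          -zm / (-(1 - zm / zp * Real.sin φ ^ 2) / Real.cos φ ^ 2) := by
        generalize 1 - zm / zp * Real.sin φ ^ 2 = D at *
        field_simp
      rw [e]
      push_cast
      ring
  · intro hpole
    rw [hw, isJacobiSnPole_I_mul_iff hk0] at hpole
    -- At a pole cos φ = 0, and the orbit is on the equator.
    rw [hy, hpole]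
    simp
  · rw [Real.sqrt_sq_eq_abs]
    rcases abs_choice (Real.cos (X τ₁ 2)) with h | h
    · left
      rw [h]
    · right
      rw [h, neg_neg]

end
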